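/- Let $\alpha$ be a limit ordinal of uncountable cofinality, let $(\Gamma_\beta)_{\beta<\alpha}$ be a family of non-trivial (discrete) groups, and let $G=G_\alpha$ be its iterated wreath product; that is, $G$ is the last term of the increasing family of groups $(G_\beta)_{\beta\le\alpha}$ determined by $G_0=\{e\}$, $G_{\beta+1}=\Gamma_\beta\wr G_\beta=\big(\bigoplus_{G_\beta}\Gamma_\beta\big)\rtimes G_\beta$ (left shift action, with $G_\beta$ embedded by $g\mapsto(e,g)$) for $\beta<\alpha$, and $G_\beta=\bigcup_{\gamma<\beta}G_\gamma$ for limit ordinals $\beta\le\alpha$. Then the following hold. 1. For every unital C*-algebra $A$, the C*-algebra $A\wr G:=\big(\bigotimes_G A\big)\rtimes_{r} G$ (reduced crossed product of the minimal tensor product $\bigotimes_G A$ by the tensor shift over the left translation action of $G$ on itself) has no non-trivial central sequences: whenever $(x_n)_{n=1}^\infty$ is a bounded sequence in $A\wr G$ with $\lim_n\|x_ny-yx_n\|=0$ for all $y\in A\wr G$, there are scalars $\lambda_n\in\mathbb{C}$ with $\lim_n\|x_n-\lambda_n 1\|=0$. 2. For every von Neumann algebra $M$ with a faithful normal state $\varphi$,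 the von Neumann algebra $(M,\varphi)\,\overline{\wr}\,G:=\big[\overline{\bigotimes}_G(M,\varphi)\big]\,\overline{\rtimes}\,G$ (von Neumann algebra crossed product of the infinite von Neumann algebra tensor product with respect to $\varphi$ by the tensor shift) has no non-trivial central sequences in the von Neumann algebra sense: whenever $(x_n)_{n=1}^\infty$ is an operator norm bounded sequence in it such that $x_ny-yx_n\to0$ $*$-strongly for all $y$ in it, there are scalars $\lambda_n\in\mathbb{C}$ with $x_n-\lambda_n1\to0$ $*$-strongly. -/

import Mathlib

open Filter Topology
open scoped ComplexOrder InnerProductSpace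

universe u v w

set_option linter.unusedSectionVars false

noncomputable section

/-! ## Iterated wreath products -/


/-- The (restricted) wreath product `Γ ≀ Λ = (⨁_Λ Γ) ⋊ Λ`, as the subgroup of the unrestricted
regular wreath product formed by the pairs `(f, g)` in which `f : Λ → Γ` has finite support. -/
def restrictedWreath (Γ : Type u) (Λ : Type w) [Group Γ] [Group Λ] : Subgroup (Γ ≀ᵣ Λ) where
  carrier := {x | (Function.mulSupport x.left).Finite}
  one_mem' := by simp
  mul_mem' {x y} hx hy := by
    refine (hx.union ((hy : Set.Finite _).image fun h => x.right * h)).subset fun h hh => ?_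
    by_contra hn
    simp only [Set.mem_union, Set.mem_image, not_or, Function.mem_mulSupport, not_not] at hn
    refine hh ?_
    have h2 : y.left (x.right⁻¹ * h) = 1 := by
      by_contra h3
      exact hn.2 ⟨_, h3, by simp⟩
    simp [hn.1, h2]
  inv_mem' {x} hx := by
    refine ((hx : Set.Finite _).image fun h => x.right⁻¹ * h).subset fun h hh => ?_
    exact ⟨x.right * h, fun h1 => hh (by simp [h1]), by simp⟩

/-- The canonical embedding `g ↦ (e, g)` of `Λ` in `Γ ≀ Λ`. -/
def restrictedWreath.incl (Γ : Type u) (Λ : Type w) [Group Γ] [Group Λ] :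
    Λ →* restrictedWreath Γ Λ where
  toFun g := ⟨RegularWreathProduct.inl g, by simp [restrictedWreath]⟩
  map_one' := by simp
  map_mul' _ _ := Subtype.ext (map_mul _ _ _)

/-- An increasing family `(G_β)_{β ≤ α}` of subgroups of `G` that exhibits `G = G_α` as the iterated
wreath product of `(Γ_β)_{β < α}`: `G_0` is trivial, `G_β = ⋃_{γ < β} G_γ` at limit ordinals, and
`G_{β + 1} = Γ_β ≀ G_β`, where `G_β ⊆ G_{β + 1}` is the canonical copy of `G_β` in `Γ_β ≀ G_β`.
The values of `stage` above `α` are irrelevant. -/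
structure IteratedWreathTower {α : Ordinal.{v}} (Γ : Set.Iio α → Type u) [∀ β, Group (Γ β)]
    (G : Type w) [Group G] where
  /-- The subgroup `G_β`, for `β ≤ α`. -/
  stage : Ordinal.{v} → Subgroup G
  mono : ∀ ⦃β γ⦄, β ≤ γ → γ ≤ α → stage β ≤ stage γ
  stage_zero : stage 0 = ⊥
  stage_limit : ∀ β ≤ α, Order.IsSuccLimit β → ∀ g, g ∈ stage β ↔ ∃ γ < β, g ∈ stage γ
  /-- The identification `G_{β + 1} = Γ_β ≀ G_β`. -/
  succEquiv : ∀ β : Set.Iio α, stage (β.1 + 1) ≃* restrictedWreath (Γ β) (stage β.1)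
  succEquiv_incl : ∀ (β : Set.Iio α) (g : stage β.1),
    succEquiv β ⟨g, mono (le_self_add) (Order.add_one_le_of_lt β.2) g.2⟩ =
      restrictedWreath.incl (Γ β) (stage β.1) g
  stage_top : stage α = ⊤

/-- `G` is the iterated wreath product of the family `(Γ_β)_{β < α}` (which is unique up to
isomorphism, and exists by `exists_isIteratedWreathProduct` below). -/
def IsIteratedWreathProduct {α : Ordinal.{v}} (Γ : Set.Iio α → Type u) [∀ β, Group (Γ β)]
    (G : Type w) [Group G] : Prop :=
  Nonempty (IteratedWreathTower Γ G)

/-! ### Existence of iterated wreath products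

An element of `G_β` is a family `(x_j)_{j < β}` with `x_j : G_j → Γ_j`, multiplied by
`(x y)_j (h) = x_j (h) * y_j ((x|_j)⁻¹ h)`, where `x|_j = (x_i)_{i < j}`. We first drop all conditions
on supports (`U`), and then pass to the finitely supported families (`Grp`). -/

namespace IteratedWreath
variable {α : Ordinal.{v}} (Γ : Set.Iio α → Type u)

/-- Families `(x_j)_{j < β}` with `x_j : U j → Γ j`. -/
def U : Ordinal.{v} → Type (max u (v + 1)) :=
  WellFounded.fix (C := fun _ => Type (max u (v + 1))) Ordinal.lt_wf
    fun β V => (j : Set.Iio α) → (h : j.1 < β) → V j.1 h → Γ j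

/-- The elements of `U β` as families. -/
def coordEquiv (β : Ordinal.{v}) : U Γ β ≃ ((j : Set.Iio α) → j.1 < β → U Γ j.1 → Γ j) :=
  Equiv.cast (WellFounded.fix_eq _ _ _)

variable {Γ}

/-- The component `x_j`. -/
def coord {β : Ordinal.{v}} (x : U Γ β) (j : Set.Iio α) (h : j.1 < β) : U Γ j.1 → Γ j :=
  coordEquiv Γ β x j h

/-- The element with given components. -/
def ofCoord {β : Ordinal.{v}} (f : (j : Set.Iio α) → j.1 < β → U Γ j.1 → Γ j) : U Γ β :=
  (coordEquiv Γ β).symm f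

@[simp] theorem coord_ofCoord {β : Ordinal.{v}}
    (f : (j : Set.Iio α) → j.1 < β → U Γ j.1 → Γ j) (j : Set.Iio α) (h : j.1 < β) :
    coord (ofCoord f) j h = f j h := by
  simp [coord, ofCoord]

theorem coord_ext {β : Ordinal.{v}} {x y : U Γ β} (h : ∀ j hj a, coord x j hj a = coord y j hj a) :
    x = y :=
  (coordEquiv Γ β).injective (funext fun j => funext fun hj => funext fun a => h j hj a)

/-- The restriction `x|_γ`. -/
def trunc {β : Ordinal.{v}} (x : U Γ β) (γ : Ordinal.{v}) (h : γ ≤ β) : U Γ γ :=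
  ofCoord fun j hj => coord x j (hj.trans_le h)

@[simp] theorem coord_trunc {β : Ordinal.{v}} (x : U Γ β) (γ : Ordinal.{v}) (h : γ ≤ β)
    (j : Set.Iio α) (hj : j.1 < γ) : coord (trunc x γ h) j hj = coord x j (hj.trans_le h) := by
  simp [trunc]

@[simp] theorem trunc_trunc {β γ δ : Ordinal.{v}} (x : U Γ β) (h : γ ≤ β) (h' : δ ≤ γ) :
    trunc (trunc x γ h) δ h' = trunc x δ (h'.trans h) :=
  coord_ext fun j hj a => by simp

theorem index_lt {α : Ordinal.{v}} (j : Set.Iio α) : j.1 < α := j.2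

variable [∀ β, Group (Γ β)]

variable (Γ) in
/-- Multiplication and inversion. -/
def ops (β₀ : Ordinal.{v}) : (U Γ β₀ → U Γ β₀ → U Γ β₀) × (U Γ β₀ → U Γ β₀) :=
  WellFounded.fix (C := fun β => (U Γ β → U Γ β → U Γ β) × (U Γ β → U Γ β)) Ordinal.lt_wf
    (fun _ ih =>
      (fun x y => ofCoord fun j hj a => coord x j hj a *
          coord y j hj ((ih j.1 hj).1 ((ih j.1 hj).2 (trunc x j.1 hj.le)) a),
        fun x => ofCoord fun j hj a => (coord x j hj ((ih j.1 hj).1 (trunc x j.1 hj.le) a))⁻¹)) β₀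

instance (β : Ordinal.{v}) : Mul (U Γ β) := ⟨(ops Γ β).1⟩
instance (β : Ordinal.{v}) : Inv (U Γ β) := ⟨(ops Γ β).2⟩
instance (β : Ordinal.{v}) : One (U Γ β) := ⟨ofCoord fun _ _ _ => 1⟩

theorem coord_mul {β : Ordinal.{v}} (x y : U Γ β) (j : Set.Iio α) (hj : j.1 < β) (a : U Γ j.1) :
    coord (x * y) j hj a = coord x j hj a * coord y j hj ((trunc x j.1 hj.le)⁻¹ * a) := by
  change coord ((ops Γ β).1 x y) j hj a = _
  rw [ops, WellFounded.fix_eq, coord_ofCoord]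
  rfl

theorem coord_inv {β : Ordinal.{v}} (x : U Γ β) (j : Set.Iio α) (hj : j.1 < β) (a : U Γ j.1) :
    coord x⁻¹ j hj a = (coord x j hj (trunc x j.1 hj.le * a))⁻¹ := by
  change coord ((ops Γ β).2 x) j hj a = _
  rw [ops, WellFounded.fix_eq, coord_ofCoord]
  rfl

@[simp] theorem coord_one {β : Ordinal.{v}} (j : Set.Iio α) (hj : j.1 < β) :
    coord (1 : U Γ β) j hj = 1 :=
  coord_ofCoord _ j hj

theorem trunc_mul {β : Ordinal.{v}} (x y : U Γ β) (γ : Ordinal.{v}) (h : γ ≤ β) :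
    trunc (x * y) γ h = trunc x γ h * trunc y γ h :=
  coord_ext fun j hj a => by simp [coord_mul]

theorem trunc_inv {β : Ordinal.{v}} (x : U Γ β) (γ : Ordinal.{v}) (h : γ ≤ β) :
    trunc x⁻¹ γ h = (trunc x γ h)⁻¹ :=
  coord_ext fun j hj a => by simp [coord_inv]

theorem trunc_one {β : Ordinal.{v}} (γ : Ordinal.{v}) (h : γ ≤ β) :
    trunc (1 : U Γ β) γ h = 1 :=
  coord_ext fun j hj a => by simp

theorem groupAxioms (β : Ordinal.{v}) : (∀ x y z : U Γ β, x * y * z = x * (y * z)) ∧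
    (∀ x : U Γ β, 1 * x = x) ∧ ∀ x : U Γ β, x⁻¹ * x = 1 := by
  induction β using WellFoundedLT.induction with
  | ind β ih =>
    refine ⟨fun x y z => coord_ext fun j hj a => ?_, fun x => coord_ext fun j hj a => ?_,
      fun x => coord_ext fun j hj a => ?_⟩
    all_goals
      let g : Group (U Γ j.1) := Group.ofLeftAxioms (ih j.1 hj).1 (ih j.1 hj).2.1 (ih j.1 hj).2.2
    · have h1 : (trunc x j.1 hj.le * trunc y j.1 hj.le)⁻¹ * a =
          (trunc y j.1 hj.le)⁻¹ * ((trunc x j.1 hj.le)⁻¹ * a) := by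
        have := mul_inv_rev (trunc x j.1 hj.le) (trunc y j.1 hj.le)
        exact (congrArg (· * a) this).trans (mul_assoc _ _ _)
      simp only [coord_mul, trunc_mul, h1, mul_assoc]
    · have h1 : (1 : U Γ j.1)⁻¹ * a = a := (congrArg (· * a) inv_one).trans (one_mul a)
      rw [coord_mul, trunc_one, h1]
      simp
    · have h1 : (trunc x j.1 hj.le)⁻¹⁻¹ * a = trunc x j.1 hj.le * a :=
        congrArg (· * a) (inv_inv (trunc x j.1 hj.le))
      rw [coord_mul, trunc_inv, h1, coord_inv]
      simp

instance (β : Ordinal.{v}) : Group (U Γ β) :=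
  Group.ofLeftAxioms (groupAxioms β).1 (groupAxioms β).2.1 (groupAxioms β).2.2

variable (Γ) in
/-- The hereditarily finitely supported families. -/
def restr (β : Ordinal.{v}) : Set (U Γ β) :=
  WellFounded.fix (C := fun β => Set (U Γ β)) Ordinal.lt_wf
    (fun β ih => {x | {j : Set.Iio α | ∃ hj : j.1 < β, coord x j hj ≠ 1}.Finite ∧
      ∀ (j : Set.Iio α) (hj : j.1 < β), (Function.mulSupport (coord x j hj)).Finite ∧
        Function.mulSupport (coord x j hj) ⊆ ih j.1 hj}) β

theorem mem_restr {β : Ordinal.{v}} {x : U Γ β} : x ∈ restr Γ β ↔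
    {j : Set.Iio α | ∃ hj : j.1 < β, coord x j hj ≠ 1}.Finite ∧
      ∀ (j : Set.Iio α) (hj : j.1 < β), (Function.mulSupport (coord x j hj)).Finite ∧
        Function.mulSupport (coord x j hj) ⊆ restr Γ j.1 := by
  rw [restr, WellFounded.fix_eq]
  rfl

theorem trunc_mem_restr {β : Ordinal.{v}} {x : U Γ β} (hx : x ∈ restr Γ β) (γ : Ordinal.{v})
    (h : γ ≤ β) : trunc x γ h ∈ restr Γ γ := by
  rw [mem_restr] at hx ⊢
  refine ⟨hx.1.subset ?_, fun j hj => ?_⟩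
  · rintro j ⟨hj, h1⟩
    exact ⟨hj.trans_le h, by simpa using h1⟩
  · simpa using hx.2 j (hj.trans_le h)

theorem restr_closed (β : Ordinal.{v}) :
    (∀ x ∈ restr Γ β, ∀ y ∈ restr Γ β, x * y ∈ restr Γ β) ∧ ∀ x ∈ restr Γ β, x⁻¹ ∈ restr Γ β := by
  induction β using WellFoundedLT.induction with
  | ind β ih =>
    refine ⟨fun x hx y hy => ?_, fun x hx => ?_⟩
    · have hx' := hx
      rw [mem_restr] at hx hy ⊢
      refine ⟨(hx.1.union hy.1).subset ?_, fun j hj => ?_⟩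
      · rintro j ⟨hj, h⟩
        by_contra hn
        simp only [Set.mem_union, Set.mem_ofPred_eq, not_or, not_exists, not_not] at hn
        refine h (funext fun a => ?_)
        rw [coord_mul, hn.1 hj, hn.2 hj]
        simp
      · have hsub : Function.mulSupport (coord (x * y) j hj) ⊆
            Function.mulSupport (coord x j hj) ∪
              (trunc x j.1 hj.le * ·) '' Function.mulSupport (coord y j hj) := by
          intro a ha
          by_contra hn
          simp only [Set.mem_union, not_or, Function.mem_mulSupport, not_not] at hn
          refine ha ?_
          rw [coord_mul, hn.1, one_mul]
          by_contra h3
          exact hn.2 ⟨_, h3, by simp⟩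
        refine ⟨((hx.2 j hj).1.union ((hy.2 j hj).1.image _)).subset hsub,
          hsub.trans (Set.union_subset (hx.2 j hj).2 ?_)⟩
        rintro _ ⟨b, hb, rfl⟩
        exact (ih j.1 hj).1 _ (trunc_mem_restr hx' _ _) _ ((hy.2 j hj).2 hb)
    · have hx' := hx
      rw [mem_restr] at hx ⊢
      refine ⟨hx.1.subset ?_, fun j hj => ?_⟩
      · rintro j ⟨hj, h⟩
        refine ⟨hj, fun h1 => h (funext fun a => ?_)⟩
        rw [coord_inv, h1]
        simp
      · have hsub : Function.mulSupport (coord x⁻¹ j hj) ⊆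
            ((trunc x j.1 hj.le)⁻¹ * ·) '' Function.mulSupport (coord x j hj) := by
          intro a ha
          refine ⟨trunc x j.1 hj.le * a, fun h => ha ?_, by simp⟩
          rw [coord_inv, h, inv_one]
        refine ⟨((hx.2 j hj).1.image _).subset hsub, hsub.trans ?_⟩
        rintro _ ⟨b, hb, rfl⟩
        exact (ih j.1 hj).1 _ ((ih j.1 hj).2 _ (trunc_mem_restr hx' _ _)) _ ((hx.2 j hj).2 hb)

variable (Γ) in
/-- The iterated wreath product. -/
def Grp : Subgroup (U Γ α) where
  carrier := restr Γ α
  mul_mem' hx hy := (restr_closed α).1 _ hx _ hy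
  one_mem' := by
    change (1 : U Γ α) ∈ restr Γ α
    rw [mem_restr]
    simp
  inv_mem' hx := (restr_closed α).2 _ hx

/-- All coordinates of an element of the group. -/
def fc (x : Grp Γ) (j : Set.Iio α) : U Γ j.1 → Γ j := coord x.1 j (index_lt j)

/-- The truncation of an element of the group at `β`. -/
def tr (β : Set.Iio α) (x : Grp Γ) : U Γ β.1 := trunc x.1 β.1 (index_lt β).le

theorem fc_mul (x y : Grp Γ) (j : Set.Iio α) (a : U Γ j.1) :
    fc (x * y) j a = fc x j a * fc y j ((tr j x)⁻¹ * a) := coord_mul _ _ _ _ _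

theorem fc_inv (x : Grp Γ) (j : Set.Iio α) (a : U Γ j.1) :
    fc x⁻¹ j a = (fc x j (tr j x * a))⁻¹ := coord_inv _ _ _ _

theorem fc_one (j : Set.Iio α) : fc (1 : Grp Γ) j = 1 := coord_one _ _

theorem fc_ext {x y : Grp Γ} (h : ∀ j a, fc x j a = fc y j a) : x = y :=
  Subtype.ext (coord_ext fun j _ a => h j a)

variable (Γ) in
/-- The families supported below `β`. -/
def stage (β : Ordinal.{v}) : Subgroup (Grp Γ) where
  carrier := {x | ∀ j : Set.Iio α, β ≤ j.1 → fc x j = 1}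
  one_mem' j _ := fc_one j
  mul_mem' {x y} hx hy j hj := by
    funext a
    rw [fc_mul, hx j hj, hy j hj]
    simp
  inv_mem' {x} hx j hj := by
    funext a
    rw [fc_inv, hx j hj]
    simp

theorem tr_mul (β : Set.Iio α) (x y : Grp Γ) : tr β (x * y) = tr β x * tr β y := trunc_mul _ _ _ _
theorem tr_inv (β : Set.Iio α) (x : Grp Γ) : tr β x⁻¹ = (tr β x)⁻¹ := trunc_inv _ _ _
theorem tr_one (β : Set.Iio α) : tr β (1 : Grp Γ) = 1 := trunc_one _ _

theorem coord_tr (β : Set.Iio α) (x : Grp Γ) (j : Set.Iio α) (hj : j.1 < β.1) :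
    coord (tr β x) j hj = fc x j := coord_trunc _ _ _ _ _

theorem tr_injOn (β : Set.Iio α) {x y : Grp Γ} (hx : x ∈ stage Γ β.1) (hy : y ∈ stage Γ β.1)
    (h : tr β x = tr β y) : x = y := by
  refine fc_ext fun j a => ?_
  rcases lt_or_ge j.1 β.1 with h1 | h1
  · rw [← coord_tr β x j h1, h, coord_tr β y j h1]
  · rw [hx j h1, hy j h1]

open Classical in
theorem exists_tr (β : Set.Iio α) {z : U Γ β.1} (hz : z ∈ restr Γ β.1) :
    ∃ x ∈ stage Γ β.1, tr β x = z := by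
  have hz' := mem_restr.1 hz
  let x : U Γ α := ofCoord fun j _ => if h : j.1 < β.1 then coord z j h else 1
  have h1 (j : Set.Iio α) (hj : j.1 < α) (h : j.1 < β.1) : coord x j hj = coord z j h := by
    rw [coord_ofCoord, dif_pos h]
  have h2 (j : Set.Iio α) (hj : j.1 < α) (h : ¬ j.1 < β.1) : coord x j hj = 1 := by
    rw [coord_ofCoord, dif_neg h]
  have hx : x ∈ restr Γ α := by
    rw [mem_restr]
    refine ⟨hz'.1.subset ?_, fun j hj => ?_⟩
    · rintro j ⟨hj, h⟩
      by_cases h3 : j.1 < β.1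
      · exact ⟨h3, by rwa [← h1 j hj h3]⟩
      · exact absurd (h2 j hj h3) h
    · by_cases h3 : j.1 < β.1
      · rw [h1 j hj h3]
        exact hz'.2 j h3
      · rw [h2 j hj h3]
        simp
  refine ⟨⟨x, hx⟩, fun j hj => h2 j _ hj.not_gt, coord_ext fun j hj a => ?_⟩
  rw [coord_tr]
  exact congrFun (h1 j _ hj) a

theorem tr_mem (β : Set.Iio α) (x : Grp Γ) : tr β x ∈ restr Γ β.1 := trunc_mem_restr x.2 _ _

/-- The projection of the group onto the `β`-th stage. -/
def low (β : Set.Iio α) (x : Grp Γ) : stage Γ β.1 :=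
  ⟨(exists_tr β (tr_mem β x)).choose, (exists_tr β (tr_mem β x)).choose_spec.1⟩

theorem tr_low (β : Set.Iio α) (x : Grp Γ) : tr β (low β x : Grp Γ) = tr β x :=
  (exists_tr β (tr_mem β x)).choose_spec.2

theorem low_eq (β : Set.Iio α) {x : Grp Γ} {g : stage Γ β.1} (h : tr β (g : Grp Γ) = tr β x) :
    low β x = g :=
  Subtype.ext (tr_injOn β (low β x).2 g.2 ((tr_low β x).trans h.symm))

theorem succ_finite (β : Set.Iio α) (x : Grp Γ) :
    (Function.mulSupport fun h : stage Γ β.1 => fc x β (tr β (h : Grp Γ))).Finite := by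
  refine Set.Finite.of_finite_image (f := fun h : stage Γ β.1 => tr β (h : Grp Γ))
    (((mem_restr.1 x.2).2 β (index_lt β)).1.subset ?_) fun a _ b _ h =>
      Subtype.ext (tr_injOn β a.2 b.2 h)
  rintro _ ⟨h, hh, rfl⟩
  exact hh

/-- The element `((h ↦ x_β(h)), x|_β)` of the wreath product. -/
def toWreath (β : Set.Iio α) (x : Grp Γ) : restrictedWreath (Γ β) (stage Γ β.1) :=
  ⟨⟨fun h => fc x β (tr β (h : Grp Γ)), low β x⟩, succ_finite β x⟩

theorem toWreath_mul (β : Set.Iio α) (x y : Grp Γ) :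
    toWreath β (x * y) = toWreath β x * toWreath β y := by
  refine Subtype.ext (RegularWreathProduct.ext (funext fun h => ?_) ?_)
  · change fc (x * y) β _ = fc x β _ * fc y β (tr β ((low β x : Grp Γ)⁻¹ * h))
    rw [fc_mul, tr_mul, tr_inv, tr_low]
  · refine low_eq β (g := low β x * low β y) ?_
    rw [tr_mul]
    change tr β ((low β x : Grp Γ) * (low β y : Grp Γ)) = _
    rw [tr_mul, tr_low, tr_low]

theorem toWreath_one (β : Set.Iio α) : toWreath β (1 : Grp Γ) = 1 := by
  refine Subtype.ext (RegularWreathProduct.ext (funext fun h => ?_) ?_)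
  · exact congrFun (fc_one β) _
  · exact low_eq β (g := 1) rfl

/-- The canonical map `G_{β + 1} → Γ_β ≀ G_β`. -/
def succHom (β : Set.Iio α) : stage Γ (β.1 + 1) →* restrictedWreath (Γ β) (stage Γ β.1) where
  toFun x := toWreath β x
  map_one' := toWreath_one β
  map_mul' x y := toWreath_mul β (x : Grp Γ) (y : Grp Γ)

open Classical in
theorem succHom_bijective (β : Set.Iio α) : Function.Bijective (succHom (Γ := Γ) β) := by
  constructor
  · intro x y h
    have hl := congrArg (fun z => z.1.left) h
    have hr : low β (x : Grp Γ) = low β (y : Grp Γ) := congrArg (fun z => z.1.right) h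
    refine Subtype.ext (fc_ext fun j a => ?_)
    rcases lt_trichotomy j.1 β.1 with h1 | h1 | h1
    · rw [← coord_tr β x.1 j h1, ← coord_tr β y.1 j h1, ← tr_low, hr, tr_low]
    · obtain rfl : j = β := Subtype.ext h1
      by_cases ha : a ∈ restr Γ j.1
      · obtain ⟨b, hb, rfl⟩ := exists_tr j ha
        exact congrFun hl ⟨b, hb⟩
      · have key (z : Grp Γ) : fc z j a = 1 := by
          by_contra hz
          exact ha (((mem_restr.1 z.2).2 j (index_lt j)).2 hz)
        rw [key x.1, key y.1]
    · rw [x.2 j (Order.add_one_le_of_lt h1), y.2 j (Order.add_one_le_of_lt h1)]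
  · rintro ⟨⟨f, g⟩, hf⟩
    have hf : (Function.mulSupport f).Finite := hf
    let F : U Γ β.1 → Γ β := fun a => if h : ∃ b : stage Γ β.1, tr β (b : Grp Γ) = a
      then f h.choose else 1
    have hF (b : stage Γ β.1) : F (tr β (b : Grp Γ)) = f b := by
      have h : ∃ c : stage Γ β.1, tr β (c : Grp Γ) = tr β (b : Grp Γ) := ⟨b, rfl⟩
      simp only [F, dif_pos h]
      exact congrArg f (Subtype.ext (tr_injOn β h.choose.2 b.2 h.choose_spec))
    have hFs : Function.mulSupport F ⊆
        (fun b : stage Γ β.1 => tr β (b : Grp Γ)) '' Function.mulSupport f := by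
      intro a ha
      by_cases h : ∃ b : stage Γ β.1, tr β (b : Grp Γ) = a
      · obtain ⟨b, rfl⟩ := h
        exact ⟨b, by rwa [Function.mem_mulSupport, ← hF], rfl⟩
      · exact absurd (dif_neg h) ha
    let x : U Γ α := ofCoord fun j hj => Function.update (fun j : Set.Iio α => fc (g : Grp Γ) j) β F j
    have hx (j : Set.Iio α) (hj : j ≠ β) : coord x j (index_lt j) = fc (g : Grp Γ) j := by simp [x, hj]
    have hxβ : coord x β (index_lt β) = F := by simp [x]
    have hg := mem_restr.1 g.1.2
    have hxm : x ∈ restr Γ α := by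
      rw [mem_restr]
      refine ⟨(hg.1.insert β).subset ?_, fun j hj => ?_⟩
      · rintro j ⟨hj, h⟩
        by_cases h1 : j = β
        · exact Or.inl h1
        · exact Or.inr ⟨hj, fun h2 => h ((hx j h1).trans h2)⟩
      · by_cases h1 : j = β
        · subst h1
          rw [hxβ]
          refine ⟨(hf.image _).subset hFs, hFs.trans ?_⟩
          rintro _ ⟨b, -, rfl⟩
          exact tr_mem j _
        · rw [hx j h1]
          exact hg.2 j hj
    refine ⟨⟨⟨x, hxm⟩, fun j hj => ?_⟩, Subtype.ext (RegularWreathProduct.ext ?_ ?_)⟩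
    · have h1 : β.1 < j.1 := Order.add_one_le_iff.1 hj
      exact (hx j fun h => h1.ne (congrArg Subtype.val h).symm).trans (g.2 j h1.le)
    · funext b
      exact (congrFun hxβ _).trans (hF b)
    · refine low_eq β (coord_ext fun j hj a => ?_)
      rw [coord_tr, coord_tr]
      exact (congrFun (hx j fun h => hj.ne (congrArg Subtype.val h)) a).symm

/-- The group `Grp Γ` is the iterated wreath product of `Γ`. -/
def tower : IteratedWreathTower Γ (Grp Γ) where
  stage := stage Γ
  mono _ _ h _ _ hx j hj := hx j (h.trans hj)
  stage_zero := by
    refine (Subgroup.eq_bot_iff_forall _).2 fun x hx => ?_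
    exact fc_ext fun j a => by rw [hx j zero_le, fc_one]
  stage_limit β hβ hl x := by
    refine ⟨fun hx => ?_, fun ⟨γ, hγ, hx⟩ j hj => hx j (hγ.le.trans hj)⟩
    have hfin := (mem_restr.1 x.2).1
    refine ⟨hfin.toFinset.sup fun j => j.1 + 1, ?_, fun j hj => ?_⟩
    · rw [Finset.sup_lt_iff hl.bot_lt]
      intro j hj
      obtain ⟨h1, h2⟩ := hfin.mem_toFinset.1 hj
      refine hl.add_one_lt (lt_of_not_ge fun h3 => h2 (hx j h3))
    · by_contra h
      have := Finset.le_sup (f := fun j : Set.Iio α => j.1 + 1) (hfin.mem_toFinset.2 ⟨index_lt j, h⟩)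
      exact absurd (this.trans hj) (lt_add_one j.1).not_ge
  succEquiv β := MulEquiv.ofBijective (succHom β) (succHom_bijective β)
  succEquiv_incl β g := by
    change toWreath β (g : Grp Γ) = _
    refine Subtype.ext (RegularWreathProduct.ext (funext fun h => ?_) ?_)
    · exact congrFun (g.2 β le_rfl) (tr β (h : Grp Γ))
    · exact low_eq β (g := g) rfl
  stage_top := by
    refine (Subgroup.eq_top_iff' _).2 fun x j hj => absurd hj (index_lt j).not_ge

end IteratedWreath

theorem exists_isIteratedWreathProduct {α : Ordinal.{v}} (Γ : Set.Iio α → Type u)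
    [∀ β, Group (Γ β)] :
    ∃ (G : Type (max u (v + 1))) (_ : Group G), IsIteratedWreathProduct Γ G :=
  ⟨IteratedWreath.Grp Γ, inferInstance, ⟨IteratedWreath.tower⟩⟩

/-! ## Infinite tensor products of Hilbert spaces -/

section Tensor
variable {H : Type*} [NormedAddCommGroup H] [InnerProductSpace ℂ H]

/-- The unit vectors of a Hilbert space. -/
abbrev UnitVector (H : Type*) [NormedAddCommGroup H] := {ξ : H // ‖ξ‖ = 1}

/-- The elementary tensors `⨂ s, x s` of `⨂_S (H, ξ)`: families of vectors of `H` that are equal to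
the reference vector `ξ` at all but finitely many `s`. -/
def ElementaryTensor (S : Type*) (ξ : UnitVector H) : Type _ :=
  {x : S → H // {s | x s ≠ ξ}.Finite}

variable {S : Type*} {ξ : UnitVector H}

/-- `⟪⨂ x s, ⨂ y s⟫ = ∏ ⟪x s, y s⟫`; all but finitely many factors are `⟪ξ, ξ⟫ = 1`. -/
def tensorKernel (S : Type*) (ξ : UnitVector H) (x y : ElementaryTensor S ξ) : ℂ :=
  ∏ᶠ s, ⟪x.1 s, y.1 s⟫_ℂ

theorem sum_sum_gram {X : Type*} (v : X → H) (u : X →₀ ℂ) :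
    (u.sum fun i xi => u.sum fun j xj => star xi * ⟪v i, v j⟫_ℂ * xj) =
      ((‖u.sum fun i c => c • v i‖ ^ 2 : ℝ) : ℂ) := by
  have h := inner_self_eq_norm_sq_to_K (𝕜 := ℂ) (u.sum fun i c => c • v i)
  rw [Finsupp.sum_inner] at h
  simp only [Finsupp.inner_sum, inner_smul_right] at h
  push_cast
  refine Eq.trans ?_ h
  refine Finset.sum_congr rfl fun i _ => ?_
  refine Finset.sum_congr rfl fun j _ => ?_
  simp only [RCLike.star_def, inner_smul_left]
  ring

theorem posSemidef_gram' {X : Type*} (v : X → H) :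
    Matrix.PosSemidef (Matrix.of fun x y => ⟪v x, v y⟫_ℂ) := by
  refine ⟨Matrix.IsHermitian.ext fun x y => by simp, fun u => ?_⟩
  refine le_of_le_of_eq ?_ (sum_sum_gram v u).symm
  exact Complex.zero_le_real.2 (by positivity)

theorem UnitVector.inner_self (ξ : UnitVector H) : ⟪(ξ : H), (ξ : H)⟫_ℂ = 1 := by
  rw [inner_self_eq_norm_sq_to_K, ξ.2]; simp

theorem tensorKernel_eq_prod (x y : ElementaryTensor S ξ) {F : Finset S}
    (hx : {s | x.1 s ≠ ξ} ⊆ F) (hy : {s | y.1 s ≠ ξ} ⊆ F) :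
    tensorKernel S ξ x y = ∏ s ∈ F, ⟪x.1 s, y.1 s⟫_ℂ := by
  refine finprod_eq_prod_of_mulSupport_subset _ fun s hs => ?_
  by_contra h
  have h1 : x.1 s = ξ := by by_contra h'; exact h (hx h')
  have h2 : y.1 s = ξ := by by_contra h'; exact h (hy h')
  exact hs (by simp only [h1, h2, UnitVector.inner_self])

theorem posSemidef_prod {X ι : Type*} (F : Finset ι) (k : ι → Matrix X X ℂ)
    (hk : ∀ s ∈ F, (k s).PosSemidef) : (Matrix.of fun x y => ∏ s ∈ F, k s x y).PosSemidef := by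
  classical
  induction F using Finset.induction_on with
  | empty => simpa using posSemidef_gram' (fun _ : X => (1 : ℂ))
  | insert s F hs ih =>
    have := (hk s (Finset.mem_insert_self s F)).hadamard
      (ih fun t ht => hk t (Finset.mem_insert_of_mem ht))
    have h : (Matrix.of fun x y => ∏ t ∈ insert s F, k t x y) =
        (k s).hadamard (Matrix.of fun x y => ∏ t ∈ F, k t x y) := by
      ext x y
      simp [Finset.prod_insert hs]
    rw [h]
    exact this

theorem exists_common_support (T : Finset (ElementaryTensor S ξ)) (s₀ : Finset S) :
    ∃ F : Finset S, s₀ ⊆ F ∧ ∀ x ∈ T, {s | x.1 s ≠ ξ} ⊆ F := by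
  classical
  refine ⟨s₀ ∪ T.biUnion fun x => x.2.toFinset, Finset.subset_union_left, fun x hx s hs => ?_⟩
  simp only [Finset.coe_union, Set.mem_union, Finset.mem_coe, Finset.mem_biUnion]
  exact Or.inr ⟨x, hx, by simpa using hs⟩

theorem posSemidef_tensorKernel : (Matrix.of (tensorKernel S ξ)).PosSemidef := by
  refine ⟨Matrix.IsHermitian.ext fun x y => ?_, fun u => ?_⟩
  · classical
    obtain ⟨F, -, hF⟩ := exists_common_support {x, y} ∅
    rw [Matrix.of_apply, Matrix.of_apply,
      tensorKernel_eq_prod y x (hF y (by simp)) (hF x (by simp)),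
      tensorKernel_eq_prod x y (hF x (by simp)) (hF y (by simp))]
    simp
  · obtain ⟨F, -, hF⟩ := exists_common_support u.support ∅
    have := (posSemidef_prod F (fun s => Matrix.of fun x y : ElementaryTensor S ξ =>
      ⟪x.1 s, y.1 s⟫_ℂ) fun s _ => posSemidef_gram' fun x : ElementaryTensor S ξ => x.1 s).2 u
    refine this.trans_eq (Finset.sum_congr rfl fun x hx => Finset.sum_congr rfl fun y hy => ?_)
    simp only [Matrix.of_apply, tensorKernel_eq_prod x y (hF x hx) (hF y hy)]

/-- The sesquilinear form with `⟪⨂ x s, ⨂ y s⟫ = ∏ ⟪x s, y s⟫` on formal linear combinations. -/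
def tensorForm (u v : ElementaryTensor S ξ →₀ ℂ) : ℂ :=
  u.sum fun x c => v.sum fun y d => star c * tensorKernel S ξ x y * d

theorem tensorForm_map (f : ElementaryTensor S ξ → ElementaryTensor S ξ)
    (u v : ElementaryTensor S ξ →₀ ℂ) :
    tensorForm (u.mapDomain f) (v.mapDomain f) = u.sum fun x c => v.sum fun y d =>
      star c * tensorKernel S ξ (f x) (f y) * d := by
  rw [tensorForm, Finsupp.sum_mapDomain_index (by simp) (by simp [add_mul])]
  refine Finset.sum_congr rfl fun x _ => ?_
  exact Finsupp.sum_mapDomain_index (by simp) (by simp [mul_add])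

/-- Formal linear combinations of elementary tensors. -/
def PreTensor (S : Type*) (ξ : UnitVector H) : Type _ := ElementaryTensor S ξ →₀ ℂ

instance : AddCommGroup (PreTensor S ξ) := inferInstanceAs (AddCommGroup (_ →₀ ℂ))
instance : Module ℂ (PreTensor S ξ) := inferInstanceAs (Module ℂ (_ →₀ ℂ))

theorem tensorForm_conj_symm (u v : ElementaryTensor S ξ →₀ ℂ) :
    (starRingEnd ℂ) (tensorForm v u) = tensorForm u v := by
  rw [tensorForm, Finsupp.sum_comm, tensorForm]
  simp only [map_finsuppSum]
  refine Finset.sum_congr rfl fun x _ => Finset.sum_congr rfl fun y _ => ?_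
  have h : star (tensorKernel S ξ y x) = tensorKernel S ξ x y :=
    posSemidef_tensorKernel.isHermitian.apply x y
  beta_reduce
  rw [← h]
  simp [mul_comm, mul_left_comm]

theorem tensorForm_add_left (u v w : ElementaryTensor S ξ →₀ ℂ) :
    tensorForm (u + v) w = tensorForm u w + tensorForm v w :=
  Finsupp.sum_add_index' (by simp) (by simp [add_mul])

theorem tensorForm_smul_left (u v : ElementaryTensor S ξ →₀ ℂ) (r : ℂ) :
    tensorForm (r • u) v = (starRingEnd ℂ) r * tensorForm u v := by
  rw [tensorForm, Finsupp.sum_smul_index (by simp), tensorForm]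
  simp [Finsupp.mul_sum, ← mul_assoc]

/-- The semi-inner product given by `tensorForm`. -/
instance preTensorCore : PreInnerProductSpace.Core ℂ (PreTensor S ξ) where
  inner u v := tensorForm u v
  conj_inner_symm u v := tensorForm_conj_symm u v
  re_inner_nonneg u := (RCLike.nonneg_iff.mp (posSemidef_tensorKernel.2 u)).1
  add_left u v w := tensorForm_add_left u v w
  smul_left u v r := tensorForm_smul_left u v r

instance : SeminormedAddCommGroup (PreTensor S ξ) :=
  InnerProductSpace.Core.toSeminormedAddCommGroup (𝕜 := ℂ)

instance : InnerProductSpace ℂ (PreTensor S ξ) := .ofCore preTensorCore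

/-- The infinite tensor product `⨂_S (H, ξ)` of Hilbert spaces with reference vector `ξ`: the
completion (after division by the null vectors) of the linear combinations of elementary tensors. -/
abbrev HilbertTensor (S : Type*) (ξ : UnitVector H) : Type _ :=
  UniformSpace.Completion (PreTensor S ξ)

/-- The linear extension of a map between elementary tensors. -/
def PreTensor.map (f : ElementaryTensor S ξ → ElementaryTensor S ξ) :
    PreTensor S ξ →ₗ[ℂ] PreTensor S ξ := Finsupp.lmapDomain ℂ ℂ f

theorem PreTensor.inner_map_map (f : ElementaryTensor S ξ → ElementaryTensor S ξ)
    (u v : PreTensor S ξ) :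
    ⟪PreTensor.map f u, PreTensor.map f v⟫_ℂ = Finsupp.sum u fun x c => Finsupp.sum v fun y d =>
      star c * tensorKernel S ξ (f x) (f y) * d :=
  tensorForm_map f u v

open Classical in
/-- The elementary tensor with `T` applied at `s`. -/
def ElementaryTensor.leg (s : S) (T : H →L[ℂ] H) (x : ElementaryTensor S ξ) :
    ElementaryTensor S ξ :=
  ⟨Function.update x.1 s (T (x.1 s)), (x.2.insert s).subset fun t ht => by
    by_cases h : t = s
    · exact Or.inl h
    · exact Or.inr (by simpa [h] using ht)⟩

/-- The elementary tensor with the factors permuted: the factor at `s` moves to `e s`. -/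
def ElementaryTensor.permute (e : Equiv.Perm S) (x : ElementaryTensor S ξ) :
    ElementaryTensor S ξ :=
  ⟨fun s => x.1 (e.symm s), (x.2.image e).subset fun s hs => ⟨e.symm s, hs, by simp⟩⟩

theorem posSemidef_sub_gram {X : Type*} (v : X → H) (T : H →L[ℂ] H) :
    Matrix.PosSemidef (Matrix.of fun x y =>
      ((‖T‖ ^ 2 : ℝ) : ℂ) * ⟪v x, v y⟫_ℂ - ⟪T (v x), T (v y)⟫_ℂ) := by
  refine ⟨Matrix.IsHermitian.ext fun x y => by simp, fun u => ?_⟩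
  have h1 : (u.sum fun i xi => u.sum fun j xj => star xi *
      (Matrix.of fun x y => ((‖T‖ ^ 2 : ℝ) : ℂ) * ⟪v x, v y⟫_ℂ - ⟪T (v x), T (v y)⟫_ℂ) i j * xj)
      = ((‖T‖ ^ 2 * ‖u.sum fun i c => c • v i‖ ^ 2 -
        ‖u.sum fun i c => c • T (v i)‖ ^ 2 : ℝ) : ℂ) := by
    rw [Complex.ofReal_sub, Complex.ofReal_mul, ← sum_sum_gram v u,
      ← sum_sum_gram (fun i => T (v i)) u]
    simp only [Finsupp.sum, Finset.mul_sum, ← Finset.sum_sub_distrib, Matrix.of_apply]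
    refine Finset.sum_congr rfl fun i _ => Finset.sum_congr rfl fun j _ => ?_
    ring
  refine le_of_le_of_eq ?_ h1.symm
  have h2 : (u.sum fun i c => c • T (v i)) = T (u.sum fun i c => c • v i) := by
    simp [Finsupp.sum, map_sum]
  rw [Complex.zero_le_real, sub_nonneg, h2, ← mul_pow]
  gcongr
  exact T.le_opNorm _

theorem PreTensor.norm_map_leg_le (s : S) (T : H →L[ℂ] H) (u : PreTensor S ξ) :
    ‖PreTensor.map (ElementaryTensor.leg s T) u‖ ≤ ‖T‖ * ‖u‖ := by
  classical
  rw [← sq_le_sq₀ (by positivity) (by positivity), mul_pow, ← @inner_self_eq_norm_sq ℂ,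
    ← @inner_self_eq_norm_sq ℂ _ _ _ _ u, PreTensor.inner_map_map]
  obtain ⟨F, hs, hF⟩ := exists_common_support u.support {s}
  have hs : s ∈ F := by simpa using hs
  have key := ((posSemidef_sub_gram (fun x : ElementaryTensor S ξ => x.1 s) T).hadamard
    (posSemidef_prod (F.erase s) (fun s => Matrix.of fun x y : ElementaryTensor S ξ =>
      ⟪x.1 s, y.1 s⟫_ℂ) fun s _ => posSemidef_gram' fun x : ElementaryTensor S ξ => x.1 s)).2 u
  have heq : (u.sum fun i xi => u.sum fun j xj => star xi *
      ((Matrix.of fun x y : ElementaryTensor S ξ =>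
        ((‖T‖ ^ 2 : ℝ) : ℂ) * ⟪x.1 s, y.1 s⟫_ℂ - ⟪T (x.1 s), T (y.1 s)⟫_ℂ).hadamard
      (Matrix.of fun x y : ElementaryTensor S ξ => ∏ t ∈ F.erase s,
        (Matrix.of fun x y : ElementaryTensor S ξ => ⟪x.1 t, y.1 t⟫_ℂ) x y)) i j * xj) =
      ((‖T‖ ^ 2 : ℝ) : ℂ) * ⟪u, u⟫_ℂ - Finsupp.sum u fun x c => Finsupp.sum u fun y d =>
      star c * tensorKernel S ξ (x.leg s T) (y.leg s T) * d := by
    change _ = ((‖T‖ ^ 2 : ℝ) : ℂ) * (Finsupp.sum u fun x c => Finsupp.sum u fun y d =>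
      star c * tensorKernel S ξ x y * d) - _
    simp only [Finsupp.sum, Finset.mul_sum, ← Finset.sum_sub_distrib]
    refine Finset.sum_congr rfl fun x hx => Finset.sum_congr rfl fun y hy => ?_
    have hleg : ∀ z ∈ u.support, {t | (z.leg s T).1 t ≠ ξ} ⊆ F := fun z hz t ht => by
      by_cases h : t = s
      · exact h ▸ hs
      · exact hF z hz (by simpa [ElementaryTensor.leg, h] using ht)
    rw [tensorKernel_eq_prod x y (hF x hx) (hF y hy),
      tensorKernel_eq_prod _ _ (hleg x hx) (hleg y hy), ← Finset.mul_prod_erase F _ hs,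
      ← Finset.mul_prod_erase F _ hs]
    have : ∏ t ∈ F.erase s, ⟪(x.leg s T).1 t, (y.leg s T).1 t⟫_ℂ
        = ∏ t ∈ F.erase s, ⟪x.1 t, y.1 t⟫_ℂ := by
      refine Finset.prod_congr rfl fun t ht => ?_
      simp [ElementaryTensor.leg, Finset.ne_of_mem_erase ht]
    rw [this]
    simp [ElementaryTensor.leg]
    ring
  rw [heq] at key
  have := (RCLike.nonneg_iff.mp key).1
  rw [map_sub, RCLike.re_to_complex, Complex.re_ofReal_mul] at this
  simpa using this

/-- The operator that applies `T` to the factor at `s`. -/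
def legOp (ξ : UnitVector H) (s : S) (T : H →L[ℂ] H) :
    HilbertTensor S ξ →L[ℂ] HilbertTensor S ξ :=
  ((PreTensor.map (ElementaryTensor.leg s T)).mkContinuous ‖T‖
    (PreTensor.norm_map_leg_le s T)).completion

theorem tensorKernel_permute (e : Equiv.Perm S) (x y : ElementaryTensor S ξ) :
    tensorKernel S ξ (x.permute e) (y.permute e) = tensorKernel S ξ x y :=
  finprod_comp_equiv e.symm (f := fun s => ⟪x.1 s, y.1 s⟫_ℂ)

theorem PreTensor.inner_map_permute (e : Equiv.Perm S) (u v : PreTensor S ξ) :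
    ⟪PreTensor.map (ElementaryTensor.permute e) u, PreTensor.map (ElementaryTensor.permute e) v⟫_ℂ
      = ⟪u, v⟫_ℂ := by
  rw [PreTensor.inner_map_map]
  simp only [tensorKernel_permute]
  rfl

/-- The operator that permutes the factors by `e`. -/
def permuteOp (ξ : UnitVector H) (e : Equiv.Perm S) :
    HilbertTensor S ξ →L[ℂ] HilbertTensor S ξ :=
  ((PreTensor.map (ElementaryTensor.permute e)).mkContinuous 1 fun u => by
    rw [one_mul, ← sq_le_sq₀ (by positivity) (by positivity), ← @inner_self_eq_norm_sq ℂ,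
      PreTensor.inner_map_permute, @inner_self_eq_norm_sq ℂ]).completion

theorem permuteOp_coe (e : Equiv.Perm S) (u : PreTensor S ξ) :
    permuteOp ξ e (u : HilbertTensor S ξ) = (PreTensor.map (ElementaryTensor.permute e) u : _) := by
  simp [permuteOp]

theorem permuteOp_mul (e f : Equiv.Perm S) :
    permuteOp ξ (e * f) = permuteOp ξ e * permuteOp ξ f := by
  ext v
  induction v using UniformSpace.Completion.induction_on with
  | hp => apply isClosed_eq <;> fun_prop
  | ih u =>
    simp only [mul_apply_eq_comp, permuteOp_coe]
    congr 1
    exact Finsupp.mapDomain_comp (M := ℂ) (v := (u : ElementaryTensor S ξ →₀ ℂ))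
      (f := ElementaryTensor.permute f) (g := ElementaryTensor.permute e)

theorem permuteOp_one : permuteOp ξ (1 : Equiv.Perm S) = 1 := by
  ext v
  induction v using UniformSpace.Completion.induction_on with
  | hp => apply isClosed_eq <;> fun_prop
  | ih u =>
    rw [one_apply_eq_self, permuteOp_coe]
    congr 1
    exact Finsupp.mapDomain_id (M := ℂ) (v := (u : ElementaryTensor S ξ →₀ ℂ))

theorem inner_permuteOp (e : Equiv.Perm S) (v w : HilbertTensor S ξ) :
    ⟪permuteOp ξ e v, permuteOp ξ e w⟫_ℂ = ⟪v, w⟫_ℂ := by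
  induction v, w using UniformSpace.Completion.induction_on₂ with
  | hp => apply isClosed_eq <;> fun_prop
  | ih u v =>
    rw [permuteOp_coe, permuteOp_coe, UniformSpace.Completion.inner_coe,
      UniformSpace.Completion.inner_coe, PreTensor.inner_map_permute e]

theorem star_permuteOp (e : Equiv.Perm S) : star (permuteOp ξ e) = permuteOp ξ e⁻¹ := by
  symm
  rw [ContinuousLinearMap.star_eq_adjoint, ContinuousLinearMap.eq_adjoint_iff]
  intro v w
  rw [← inner_permuteOp e, ← mul_apply_eq_comp,
    ← permuteOp_mul, mul_inv_cancel, permuteOp_one, one_apply_eq_self]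

/-- The unitary representation of the permutations of `S` on `⨂_S (H, ξ)`. -/
def permuteUnitary (S : Type*) (ξ : UnitVector H) :
    Equiv.Perm S →* unitary (HilbertTensor S ξ →L[ℂ] HilbertTensor S ξ) where
  toFun e := ⟨permuteOp ξ e, by
    rw [Unitary.mem_iff, star_permuteOp, ← permuteOp_mul, ← permuteOp_mul]
    simp [permuteOp_one]⟩
  map_one' := Subtype.ext permuteOp_one
  map_mul' e f := Subtype.ext (permuteOp_mul e f)
end Tensor

/-! ## Von Neumann algebras, crossed products -/

section VonNeumann
variable {H : Type*} [NormedAddCommGroup H] [InnerProductSpace ℂ H] [CompleteSpace H]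

instance VonNeumannAlgebra.isClosed_toStarSubalgebra (M : VonNeumannAlgebra H) :
    IsClosed (M.toStarSubalgebra : Set (H →L[ℂ] H)) := by
  rw [M.coe_toStarSubalgebra, ← M.centralizer_centralizer]
  exact Set.isClosed_centralizer _

/-- The elements of `M` are ordered as operators on `H`. -/
instance VonNeumannAlgebra.starOrderedRing (M : VonNeumannAlgebra H) :
    StarOrderedRing M.toStarSubalgebra := by
  refine StarOrderedRing.of_nonneg_iff' (fun {x y} h z => ?_) fun x => ⟨fun h => ?_, ?_⟩
  · exact add_le_add_right (show (x : H →L[ℂ] H) ≤ y from h) (z : H →L[ℂ] H)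
  · have h0 : (0 : H →L[ℂ] H) ≤ x := h
    have hm : CFC.sqrt (x : H →L[ℂ] H) ∈ M.toStarSubalgebra := by
      change CFC.sqrt (x : H →L[ℂ] H) ∈ (M : Set (H →L[ℂ] H))
      rw [← M.centralizer_centralizer]
      intro y hy
      have hc : Commute (x : H →L[ℂ] H) y := hy x x.2
      exact (hc.cfcₙ_nnreal NNReal.sqrt).eq.symm
    refine ⟨⟨_, hm⟩, Subtype.ext ?_⟩
    change (x : H →L[ℂ] H) = star (CFC.sqrt (x : H →L[ℂ] H)) * CFC.sqrt (x : H →L[ℂ] H)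
    rw [(IsSelfAdjoint.of_nonneg (CFC.sqrt_nonneg _)).star_eq, CFC.sqrt_mul_sqrt_self _ h0]
  · rintro ⟨s, rfl⟩
    exact star_mul_self_nonneg (s : H →L[ℂ] H)

/-- The von Neumann algebra generated by `S`, the double commutant of `S ∪ S⋆`. -/
def VonNeumannAlgebra.generate (S : Set (H →L[ℂ] H)) : VonNeumannAlgebra H where
  toStarSubalgebra := StarSubalgebra.centralizer ℂ
    (StarSubalgebra.centralizer ℂ S : Set (H →L[ℂ] H))
  centralizer_centralizer' := by simp

end VonNeumann

section Crossed
variable {G : Type*} [Group G]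
variable {K : Type*} [NormedAddCommGroup K] [InnerProductSpace ℂ K] [CompleteSpace K]

theorem summable_sq_of_lp (ζ : lp (fun _ : G => K) 2) : Summable fun t => ‖ζ t‖ ^ 2 := by
  simpa using (lp.memℓp ζ).summable (by norm_num)

theorem lp_norm_sq (ζ : lp (fun _ : G => K) 2) : ‖ζ‖ ^ 2 = ∑' t, ‖ζ t‖ ^ 2 := by
  simpa using lp.norm_rpow_eq_tsum (p := 2) (by norm_num) ζ

theorem memℓp_two_of_summable {f : G → K} (hf : Summable fun t => ‖f t‖ ^ 2) :
    Memℓp (E := fun _ : G => K) f 2 :=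
  memℓp_gen (by simpa using hf)

/-- `(ζ_t)_t ↦ (T_t ζ_t)_t` on `ℓ²(G, K)`, for a uniformly bounded family of operators. -/
def diagOp (T : G → K →L[ℂ] K) (C : ℝ) (hT : ∀ t, ‖T t‖ ≤ C) :
    lp (fun _ : G => K) 2 →L[ℂ] lp (fun _ : G => K) 2 :=
  have hle (ζ : lp (fun _ : G => K) 2) (t : G) : ‖T t (ζ t)‖ ^ 2 ≤ C ^ 2 * ‖ζ t‖ ^ 2 := by
    rw [← mul_pow]
    gcongr
    exact (T t).le_of_opNorm_le (hT t) _
  have hsum (ζ : lp (fun _ : G => K) 2) : Summable fun t => ‖T t (ζ t)‖ ^ 2 :=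
    .of_nonneg_of_le (fun _ => by positivity) (hle ζ) ((summable_sq_of_lp ζ).mul_left _)
  LinearMap.mkContinuous
    { toFun := fun ζ => ⟨fun t => T t (ζ t), memℓp_two_of_summable (hsum ζ)⟩
      map_add' := fun ζ η => by ext t; simp; rfl
      map_smul' := fun c ζ => by ext t; simp } C fun ζ => by
    have hC : 0 ≤ C := (norm_nonneg _).trans (hT 1)
    rw [← sq_le_sq₀ (by positivity) (by positivity), mul_pow, lp_norm_sq, lp_norm_sq,
      ← tsum_mul_left]
    exact (hsum ζ).tsum_le_tsum (hle ζ) ((summable_sq_of_lp ζ).mul_left _)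

/-- The left translation `(λ_g ζ)(t) = ζ(g⁻¹ t)` on `ℓ²(G, K)`. -/
def translationOp (K : Type*) [NormedAddCommGroup K] [InnerProductSpace ℂ K] [CompleteSpace K]
    (g : G) :
    lp (fun _ : G => K) 2 →L[ℂ] lp (fun _ : G => K) 2 :=
  LinearMap.mkContinuous
    { toFun := fun ζ => ⟨fun t => ζ (g⁻¹ * t), memℓp_two_of_summable
        ((Equiv.mulLeft g⁻¹).summable_iff.2 (summable_sq_of_lp ζ))⟩
      map_add' := fun ζ η => by ext t; simp; rfl
      map_smul' := fun c ζ => by ext t; simp } 1 fun ζ => by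
    rw [one_mul, ← sq_le_sq₀ (by positivity) (by positivity), lp_norm_sq, lp_norm_sq]
    exact ((Equiv.mulLeft g⁻¹).tsum_eq fun t => ‖ζ t‖ ^ 2).le

theorem norm_conj_unitary_le (u : unitary (K →L[ℂ] K)) (b : K →L[ℂ] K) :
    ‖(star u : unitary (K →L[ℂ] K)) * b * (u : K →L[ℂ] K)‖ ≤ ‖b‖ := by
  rw [CStarRing.norm_mul_coe_unitary, CStarRing.norm_coe_unitary_mul]

/-- `(π(b) ζ)(t) = α_{t⁻¹}(b) ζ(t)` for the action `α_t(b) = U_t b U_t⋆`. -/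
def coeffOp (U : G →* unitary (K →L[ℂ] K)) (b : K →L[ℂ] K) :
    lp (fun _ : G => K) 2 →L[ℂ] lp (fun _ : G => K) 2 :=
  diagOp (fun t => (star (U t) : unitary (K →L[ℂ] K)) * b * (U t : K →L[ℂ] K)) ‖b‖
    fun t => norm_conj_unitary_le (U t) b


/-- The reduced crossed product `B ⋊_r G` of a C⋆-algebra `B ⊆ B(K)` by the action
`α_g(b) = U_g b U_g⋆`: the C⋆-algebra on `ℓ²(G, K)` generated by the `π(b)` and the `λ_g`. -/
def reducedCrossedProduct (U : G →* unitary (K →L[ℂ] K)) (B : StarSubalgebra ℂ (K →L[ℂ] K)) :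
    StarSubalgebra ℂ (lp (fun _ : G => K) 2 →L[ℂ] lp (fun _ : G => K) 2) :=
  (StarAlgebra.adjoin ℂ (coeffOp U '' B ∪ Set.range (translationOp K))).topologicalClosure

instance isClosed_reducedCrossedProduct (U : G →* unitary (K →L[ℂ] K))
    (B : StarSubalgebra ℂ (K →L[ℂ] K)) :
    IsClosed (reducedCrossedProduct U B :
      Set (lp (fun _ : G => K) 2 →L[ℂ] lp (fun _ : G => K) 2)) :=
  StarSubalgebra.isClosed_topologicalClosure _

/-- The von Neumann algebra crossed product of `N ⊆ B(K)` by the action `α_g(b) = U_g b U_g⋆`. -/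
def vonNeumannCrossedProduct (U : G →* unitary (K →L[ℂ] K)) (N : VonNeumannAlgebra K) :
    VonNeumannAlgebra (lp (fun _ : G => K) 2) :=
  VonNeumannAlgebra.generate (coeffOp U '' N ∪ Set.range (translationOp K))

end Crossed

section Wreath
variable {A : Type*} [CStarAlgebra A]
variable {H : Type*} [NormedAddCommGroup H] [InnerProductSpace ℂ H] [CompleteSpace H]

/-- The minimal tensor product `⨂_S A`, for a faithful representation `π` of `A` on `H`: the
C⋆-algebra on `⨂_S (H, ξ)` generated by the copies of `π(A)` in the tensor factors. It does not
depend on the choice of `π` and `ξ`. -/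
def minTensor (π : A →⋆ₐ[ℂ] (H →L[ℂ] H)) (ξ : UnitVector H) (S : Type*) :
    StarSubalgebra ℂ (HilbertTensor S ξ →L[ℂ] HilbertTensor S ξ) :=
  (StarAlgebra.adjoin ℂ {T | ∃ (s : S) (a : A), T = legOp ξ s (π a)}).topologicalClosure

/-- The von Neumann algebra on `⨂_S (H, ξ)` generated by the copies of `π(A)` in the tensor
factors. -/
def vonNeumannTensor (π : A →⋆ₐ[ℂ] (H →L[ℂ] H)) (ξ : UnitVector H) (S : Type*) :
    VonNeumannAlgebra (HilbertTensor S ξ) :=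
  VonNeumannAlgebra.generate {T | ∃ (s : S) (a : A), T = legOp ξ s (π a)}

/-- The unitaries on `⨂_G (H, ξ)` that implement the tensor shift over the left translation action
of `G` on itself. -/
def tensorShift (G : Type*) [Group G] (ξ : UnitVector H) :
    G →* unitary (HilbertTensor G ξ →L[ℂ] HilbertTensor G ξ) :=
  (permuteUnitary G ξ).comp (MulAction.toPermHom G G)

/-- The C⋆-algebra `A ≀ G = (⨂_G A) ⋊_r G`, for a faithful representation `π` of `A` on `H`. -/
def cstarWreath (π : A →⋆ₐ[ℂ] (H →L[ℂ] H)) (ξ : UnitVector H) (G : Type*) [Group G] :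
    StarSubalgebra ℂ (lp (fun _ : G => HilbertTensor G ξ) 2 →L[ℂ]
      lp (fun _ : G => HilbertTensor G ξ) 2) :=
  reducedCrossedProduct (tensorShift G ξ) (minTensor π ξ G)

instance isClosed_cstarWreath (π : A →⋆ₐ[ℂ] (H →L[ℂ] H)) (ξ : UnitVector H) (G : Type*)
    [Group G] : IsClosed (cstarWreath π ξ G : Set (lp (fun _ : G => HilbertTensor G ξ) 2 →L[ℂ]
      lp (fun _ : G => HilbertTensor G ξ) 2)) :=
  isClosed_reducedCrossedProduct _ _

/-- A faithful normal state on a von Neumann algebra. -/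
structure IsFaithfulNormalState {M : VonNeumannAlgebra H} (φ : M.toStarSubalgebra →ₚ[ℂ] ℂ) :
    Prop where
  map_one : φ 1 = 1
  faithful : ∀ x, 0 ≤ x → φ x = 0 → x = 0
  /-- Normality: `φ` is `σ`-weakly continuous. -/
  normal : ∃ ξ η : ℕ → H, (Summable fun n => ‖ξ n‖ ^ 2) ∧ (Summable fun n => ‖η n‖ ^ 2) ∧
    ∀ x : M.toStarSubalgebra, HasSum (fun n => ⟪η n, (x : H →L[ℂ] H) (ξ n)⟫_ℂ) (φ x)

/-- The canonical cyclic unit vector `ξ_φ` of the GNS space `L²(M, φ)`. -/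
def gnsVector {M : VonNeumannAlgebra H} (φ : M.toStarSubalgebra →ₚ[ℂ] ℂ) (hφ : φ 1 = 1) :
    UnitVector φ.GNS :=
  ⟨(φ.toPreGNS 1 : φ.PreGNS), by
    rw [UniformSpace.Completion.norm_coe, PositiveLinearMap.preGNS_norm_def]
    simp [hφ]⟩

/-- The von Neumann algebra `(M, φ) ≀ G`, the crossed product by the tensor shift of
`⨂_G (M, φ)`, which acts on `⨂_G (L²(M, φ), ξ_φ)`. -/
def vonNeumannWreath {M : VonNeumannAlgebra H} (φ : M.toStarSubalgebra →ₚ[ℂ] ℂ) (hφ : φ 1 = 1)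
    (G : Type*) [Group G] :
    VonNeumannAlgebra (lp (fun _ : G => HilbertTensor G (gnsVector φ hφ)) 2) :=
  vonNeumannCrossedProduct (tensorShift G (gnsVector φ hφ))
    (vonNeumannTensor φ.gnsStarAlgHom (gnsVector φ hφ) G)

end Wreath

section Central

/-- A unital C⋆-algebra has no non-trivial central sequences: every bounded sequence `(x_n)` with
`‖x_n y - y x_n‖ → 0` for all `y` satisfies `‖x_n - c_n‖ → 0` for some scalars `c_n`. -/
def NoNontrivialCentralSequences (D : Type*) [CStarAlgebra D] : Prop :=
  ∀ x : ℕ → D, (∃ C : ℝ, ∀ n, ‖x n‖ ≤ C) →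
    (∀ y : D, Tendsto (fun n => ‖x n * y - y * x n‖) atTop (𝓝 0)) →
    ∃ c : ℕ → ℂ, Tendsto (fun n => ‖x n - algebraMap ℂ D (c n)‖) atTop (𝓝 0)

variable {K : Type*} [NormedAddCommGroup K] [InnerProductSpace ℂ K] [CompleteSpace K]

/-- `x_n → 0` `⋆`-strongly. -/
def TendstoStarStronglyZero (x : ℕ → K →L[ℂ] K) : Prop :=
  ∀ v : K, Tendsto (fun n => x n v) atTop (𝓝 0) ∧ Tendsto (fun n => star (x n) v) atTop (𝓝 0)

/-- A von Neumann algebra has no non-trivial central sequences (in the von Neumann algebra sense):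
every bounded sequence `(x_n)` with `x_n y - y x_n → 0` `⋆`-strongly for all `y` satisfies
`x_n - c_n → 0` `⋆`-strongly for some scalars `c_n`. -/
def VonNeumannAlgebra.NoNontrivialCentralSequences (N : VonNeumannAlgebra K) : Prop :=
  ∀ x : ℕ → K →L[ℂ] K, (∀ n, x n ∈ N) → (∃ C : ℝ, ∀ n, ‖x n‖ ≤ C) →
    (∀ y ∈ N, TendstoStarStronglyZero fun n => x n * y - y * x n) →
    ∃ c : ℕ → ℂ, TendstoStarStronglyZero fun n => x n - algebraMap ℂ (K →L[ℂ] K) (c n)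

end Central

end

/-! The only group theory needed is `HasFreeConjugators`. Since `α` has uncountable cofinality, a
countable subset of `G` lies in some stage `Λ = G_β` with `β < α`, and the next stage contains an
element `g`, a non-trivial element of `Γ_β` placed at the identity coordinate, with `Λ ∩ g Λ g⁻¹ =
{1}` and `g ∉ Λ`. Countable supports of countably many operators and vectors can therefore be moved
off themselves by one translation `λ_g`.

Let `Ω = δ_1 ⊗ ⨂ ξ`. In the C⋆-case each `x_n` lies in the C⋆-algebra of a countable subset of `G`.
If `Λ` contains these subsets, then on vectors supported in `Λ` the conjugate `λ_g x_n λ_g⁻¹` has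
the matrix coefficients of the scalar `c_n = ⟪Ω, x_n Ω⟫` (`inner_conj_translationOp`). Enlarge `Λ`
so that it also supports vectors `w_n` that nearly attain the norm of `x_n - c_n`, and their images.
Pairing `[x_n, λ_g] λ_g⁻¹ w_n` with `(x_n - c_n) w_n` bounds `‖x_n - c_n‖` by `2 ‖[x_n, λ_g]‖`,
which tends to `0`.

In the von Neumann case only the vectors `x_n Ω` are used. The twisted right translation `ρ_g` lies
in the commutant, and on vectors supported in `Λ` the unitary `λ_g ρ_g` has the matrix coefficients
of the projection onto `ℂ Ω` (`inner_translationOp_rightOp`). This gives `‖(x_n - c_n) Ω‖ ≤ ‖[x_n,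
λ_g] ρ_g Ω‖`. Since `Ω` is cyclic for the commutant (`commutantOrbit_eq_top`) and the sequence is
bounded, `x_n - c_n → 0` strongly; the same argument applies to the adjoints.

Cyclicity of `Ω` reduces to cyclicity of `ξ_φ` for the commutant of the GNS representation.
Normality dominates `φ` by a vector functional of an amplification of `M`, which yields an injective
intertwiner `K` of `L²(M, φ)` into the amplification. Faithfulness makes `K ξ_φ` separating, hence
cyclic for the amplified commutant, and compressing by `K` brings cyclicity back to `ξ_φ`. -/

/-- Every countable subset of `G` lies in a subgroup `Λ` such that some `g ∉ Λ` satisfies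
`Λ ∩ g Λ g⁻¹ = {1}`. -/
def HasFreeConjugators (G : Type*) [Group G] : Prop :=
  ∀ C : Set G, C.Countable →
    ∃ Λ : Subgroup G, C ⊆ Λ ∧ ∃ g ∉ Λ, ∀ h ∈ Λ, g⁻¹ * h * g ∈ Λ → h = 1

/-! ### Free conjugators in iterated wreath products. -/

namespace IteratedWreathTower
variable {α : Ordinal.{v}} {Γ : Set.Iio α → Type u} [∀ β, Group (Γ β)] {G : Type w} [Group G]

/-- Each element appears at a stage below `α`, and countably many ordinals below `α` have supremum
below `α` by uncountable cofinality. -/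
theorem exists_subset_stage (T : IteratedWreathTower Γ G) (hα : Order.IsSuccLimit α)
    (hcof : Cardinal.aleph0 < α.cof) {C : Set G} (hC : C.Countable) :
    ∃ β : Set.Iio α, C ⊆ T.stage β.1 := by
  have hex (g : G) : ∃ γ < α, g ∈ T.stage γ :=
    (T.stage_limit α le_rfl hα g).1 (T.stage_top ▸ Subgroup.mem_top g)
  choose γ hγ hmem using hex
  have : Countable C := hC
  have hlt : (⨆ c : C, γ c) < α := by
    refine Ordinal.lift_iSup_lt_of_lt_cof ?_ fun c => hγ c
    refine (Cardinal.lift_le_aleph0.2 (Cardinal.mk_le_aleph0 (α := C))).trans_lt ?_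
    simpa using Cardinal.lift_strictMono hcof
  -- The supremum bounds its terms only if the index set is small in the universe of the ordinals;
  -- countability ensures this.
  have : Small.{v} C := small_of_injective (Encodable.ofCountable C |>.encode_injective)
  exact ⟨⟨_, hlt⟩, fun c hc => T.mono (Ordinal.le_iSup (fun c : C => γ c) ⟨c, hc⟩) hlt.le (hmem c)⟩

-- The witness is `(δ_1^c, 1)` in `Γ_β ≀ G_β` with `c ≠ 1`. Left multiplication by `h` moves the
-- support `{1}` to `{h}`, whereas right multiplication by an element of `G_β` leaves it in place,
-- so `h g = g k` forces `h = 1`.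
open Classical in
theorem exists_free_conjugator (T : IteratedWreathTower Γ G) (β : Set.Iio α) [Nontrivial (Γ β)] :
    ∃ g ∉ T.stage β.1, ∀ h ∈ T.stage β.1, g⁻¹ * h * g ∈ T.stage β.1 → h = 1 := by
  obtain ⟨c, hc⟩ := exists_ne (1 : Γ β)
  let a : restrictedWreath (Γ β) (T.stage β.1) :=
    ⟨⟨Pi.mulSingle 1 c, 1⟩, (Set.finite_singleton 1).subset Pi.mulSupport_mulSingle_subset⟩
  have hle : T.stage β.1 ≤ T.stage (β.1 + 1) := T.mono le_self_add (Order.add_one_le_of_lt β.2)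
  have hincl (k : G) (hk : k ∈ T.stage β.1) :
      T.succEquiv β ⟨k, hle hk⟩ = restrictedWreath.incl (Γ β) (T.stage β.1) ⟨k, hk⟩ :=
    T.succEquiv_incl β ⟨k, hk⟩
  set g := (T.succEquiv β).symm a with hg
  have hga : T.succEquiv β g = a := by simp [hg]
  refine ⟨g, fun hmem => hc ?_, fun h hh hk => ?_⟩
  · have h1 := hincl _ hmem
    rw [Subtype.coe_eta, hga] at h1
    simpa [a, restrictedWreath.incl] using congrFun (congrArg (fun z => z.1.left) h1) 1
  · have h1 : (⟨h, hle hh⟩ : T.stage (β.1 + 1)) * g = g * ⟨_, hle hk⟩ := by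
      ext; simp [mul_assoc]
    have h2 := congrArg (T.succEquiv β) h1
    rw [map_mul, map_mul, hincl h hh, hincl _ hk, hga] at h2
    -- At the coordinate `1`, the base part of `h g` is the value of `δ_1^c` at `h⁻¹`, and that of
    -- `g k` is `c`.
    have h3 := congrFun (congrArg (fun z => z.1.left) h2) 1
    by_contra hne
    have h4 : (⟨h, hh⟩ : T.stage β.1)⁻¹ ≠ 1 := by
      simpa [Subtype.ext_iff] using hne
    simp [a, restrictedWreath.incl, Pi.mulSingle_eq_of_ne h4] at h3
    exact hc h3.symm

end IteratedWreathTower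

theorem IsIteratedWreathProduct.hasFreeConjugators {α : Ordinal.{v}} (hα : Order.IsSuccLimit α)
    (hcof : Cardinal.aleph0 < α.cof) {Γ : Set.Iio α → Type u} [∀ β, Group (Γ β)]
    (hΓ : ∀ β, Nontrivial (Γ β)) {G : Type w} [Group G] (hG : IsIteratedWreathProduct Γ G) :
    HasFreeConjugators G := by
  obtain ⟨T⟩ := hG
  intro C hC
  obtain ⟨β, hβ⟩ := T.exists_subset_stage hα hcof hC
  have := hΓ β
  exact ⟨T.stage β.1, hβ, T.exists_free_conjugator β⟩

noncomputable section

/-! ## Spanning vectors -/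

/-- The vector is the limit of a sequence of finite combinations, which together involve countably
many vectors of `s`. -/
theorem Submodule.exists_countable_mem_topologicalClosure_span {E : Type*} [NormedAddCommGroup E]
    [NormedSpace ℂ E] {s : Set E} {v : E} (hv : v ∈ (Submodule.span ℂ s).topologicalClosure) :
    ∃ t ⊆ s, t.Countable ∧ v ∈ (Submodule.span ℂ t).topologicalClosure := by
  obtain ⟨f, hf, hlim⟩ := mem_closure_iff_seq_limit.1 (show v ∈ closure _ from hv)
  choose F hF hFf using fun n => Submodule.mem_span_finite_of_mem_span (hf n)
  refine ⟨⋃ n, (F n : Set E), Set.iUnion_subset hF,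
    Set.countable_iUnion fun n => (F n).countable_toSet, ?_⟩
  exact mem_closure_iff_seq_limit.2
    ⟨f, fun n => Submodule.span_mono (Set.subset_iUnion _ n) (hFf n), hlim⟩

section Vectors
variable {H : Type*} [NormedAddCommGroup H] [InnerProductSpace ℂ H]

namespace ElementaryTensor
variable {S : Type*} {ξ : UnitVector H}

/-- The elementary tensor as a vector of `⨂_S (H, ξ)`. -/
def vec (x : ElementaryTensor S ξ) : HilbertTensor S ξ :=
  ↑(show PreTensor S ξ from (Finsupp.single x 1 : ElementaryTensor S ξ →₀ ℂ))

@[ext] theorem ext {x y : ElementaryTensor S ξ} (h : ∀ s, x.1 s = y.1 s) : x = y :=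
  Subtype.ext (funext h)

variable (ξ) in
/-- The elementary tensor `⨂ ξ`. -/
def base (S : Type*) : ElementaryTensor S ξ := ⟨fun _ => ξ, by simp⟩

@[simp] theorem base_apply (s : S) : (base ξ S).1 s = ξ := rfl

@[simp] theorem leg_apply_self (s : S) (T : H →L[ℂ] H) (x : ElementaryTensor S ξ) :
    (x.leg s T).1 s = T (x.1 s) := by simp [leg]

theorem leg_apply_ne {s t : S} (T : H →L[ℂ] H) (x : ElementaryTensor S ξ) (h : t ≠ s) :
    (x.leg s T).1 t = x.1 t := by simp [leg, h]

theorem inner_vec (x y : ElementaryTensor S ξ) : ⟪x.vec, y.vec⟫_ℂ = tensorKernel S ξ x y := by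
  rw [vec, vec, UniformSpace.Completion.inner_coe]
  change tensorForm _ _ = _
  simp [tensorForm]

theorem span_vec : (Submodule.span ℂ (Set.range (vec (ξ := ξ) (S := S)))).topologicalClosure = ⊤ := by
  rw [eq_top_iff]
  rintro v -
  induction v using UniformSpace.Completion.induction_on with
  | hp => exact Submodule.isClosed_topologicalClosure _
  | ih u =>
    refine Submodule.le_topologicalClosure _ ?_
    have h : (u : HilbertTensor S ξ) =
        Finsupp.sum (u : ElementaryTensor S ξ →₀ ℂ) fun x c => c • x.vec := by
      have h1 : u = Finsupp.sum (u : ElementaryTensor S ξ →₀ ℂ) fun x c =>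
          c • (Finsupp.single x 1 : ElementaryTensor S ξ →₀ ℂ) := by
        simp only [Finsupp.smul_single, smul_eq_mul, mul_one]
        exact (Finsupp.sum_single (u : ElementaryTensor S ξ →₀ ℂ)).symm
      change UniformSpace.Completion.toComplL (𝕜 := ℂ) (E := PreTensor S ξ) u = _
      conv_lhs => rw [h1]
      exact (map_sum (UniformSpace.Completion.toComplL (𝕜 := ℂ) (E := PreTensor S ξ)) _ _).trans
        (Finset.sum_congr rfl fun x _ =>
          map_smul (UniformSpace.Completion.toComplL (𝕜 := ℂ) (E := PreTensor S ξ)) _ _)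
    rw [h]
    exact Submodule.sum_mem _ fun x _ =>
      Submodule.smul_mem _ _ (Submodule.subset_span (Set.mem_range_self x))

theorem legOp_vec (s : S) (T : H →L[ℂ] H) (x : ElementaryTensor S ξ) :
    legOp ξ s T x.vec = (x.leg s T).vec := by
  rw [vec, legOp, ContinuousLinearMap.completion_apply_coe]
  congr 1
  exact Finsupp.mapDomain_single

theorem permuteOp_vec (e : Equiv.Perm S) (x : ElementaryTensor S ξ) :
    permuteOp ξ e x.vec = (x.permute e).vec := by
  rw [vec, permuteOp_coe]
  congr 1
  exact Finsupp.mapDomain_single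

end ElementaryTensor

/-- Operators that agree on the elementary tensors are equal. -/
theorem HilbertTensor.clm_ext {S : Type*} {ξ : UnitVector H} {E : Type*} [NormedAddCommGroup E]
    [NormedSpace ℂ E] {T T' : HilbertTensor S ξ →L[ℂ] E}
    (h : ∀ x : ElementaryTensor S ξ, T x.vec = T' x.vec) : T = T' :=
  ContinuousLinearMap.ext_on
    ((Submodule.dense_iff_topologicalClosure_eq_top).2 ElementaryTensor.span_vec)
    (by rintro _ ⟨x, rfl⟩; exact h x)

/-! ### Vectors of the crossed product space and their supports. -/

variable {G : Type*} [Group G] {ξ : UnitVector H}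

namespace ElementaryTensor

/-- The tensor shift on elementary tensors. -/
def shift (g : G) (x : ElementaryTensor G ξ) : ElementaryTensor G ξ :=
  x.permute (MulAction.toPerm g)

@[simp] theorem shift_apply (g r : G) (x : ElementaryTensor G ξ) :
    (x.shift g).1 r = x.1 (g⁻¹ * r) := rfl

@[simp] theorem shift_shift (g h : G) (x : ElementaryTensor G ξ) :
    (x.shift g).shift h = x.shift (h * g) := by
  ext r; simp [mul_assoc]

@[simp] theorem shift_one (x : ElementaryTensor G ξ) : x.shift 1 = x := by
  ext r; simp

@[simp] theorem shift_base (g : G) : (base ξ G).shift g = base ξ G := rfl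

end ElementaryTensor

theorem tensorKernel_shift (g : G) (x y : ElementaryTensor G ξ) :
    tensorKernel G ξ (x.shift g) (y.shift g) = tensorKernel G ξ x y :=
  tensorKernel_permute _ x y

theorem tensorShift_vec (g : G) (x : ElementaryTensor G ξ) :
    (tensorShift G ξ g : HilbertTensor G ξ →L[ℂ] HilbertTensor G ξ) x.vec = (x.shift g).vec :=
  ElementaryTensor.permuteOp_vec _ x

theorem star_tensorShift_vec (g : G) (x : ElementaryTensor G ξ) :
    ((star (tensorShift G ξ g) : unitary (HilbertTensor G ξ →L[ℂ] HilbertTensor G ξ)) :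
      HilbertTensor G ξ →L[ℂ] HilbertTensor G ξ) x.vec = (x.shift g⁻¹).vec := by
  rw [Unitary.star_eq_inv, ← map_inv, tensorShift_vec]

open Classical in
/-- The vector `δ_t ⊗ U_t⋆ x` of `ℓ²(G, ⨂_G (H, ξ))`. -/
def wreathVec (t : G) (x : ElementaryTensor G ξ) : lp (fun _ : G => HilbertTensor G ξ) 2 :=
  lp.single 2 t (x.shift t⁻¹).vec

theorem wreathVec_apply_self (t : G) (x : ElementaryTensor G ξ) :
    wreathVec t x t = (x.shift t⁻¹).vec := by
  simp [wreathVec]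

theorem wreathVec_apply_ne {s t : G} (x : ElementaryTensor G ξ) (h : s ≠ t) :
    wreathVec t x s = 0 := by
  simp [wreathVec, h]

theorem inner_wreathVec_self (t : G) (x y : ElementaryTensor G ξ) :
    ⟪wreathVec t x, wreathVec t y⟫_ℂ = tensorKernel G ξ x y := by
  classical
  rw [wreathVec, lp.inner_single_left, wreathVec_apply_self, ElementaryTensor.inner_vec,
    tensorKernel_shift]

theorem inner_wreathVec_ne {s t : G} (h : s ≠ t) (x y : ElementaryTensor G ξ) :
    ⟪wreathVec s x, wreathVec t y⟫_ℂ = 0 := by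
  classical
  rw [wreathVec, lp.inner_single_left, wreathVec_apply_ne y h, inner_zero_right]

theorem translationOp_apply (g t : G) (ζ : lp (fun _ : G => HilbertTensor G ξ) 2) :
    translationOp (HilbertTensor G ξ) g ζ t = ζ (g⁻¹ * t) := rfl

theorem coeffOp_apply (b : HilbertTensor G ξ →L[ℂ] HilbertTensor G ξ) (t : G)
    (ζ : lp (fun _ : G => HilbertTensor G ξ) 2) :
    coeffOp (tensorShift G ξ) b ζ t =
      ((star (tensorShift G ξ t) : unitary (HilbertTensor G ξ →L[ℂ] HilbertTensor G ξ)) :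
        HilbertTensor G ξ →L[ℂ] HilbertTensor G ξ)
        (b ((tensorShift G ξ t : HilbertTensor G ξ →L[ℂ] HilbertTensor G ξ) (ζ t))) := rfl

/-- The twist by `U_t⋆` in `wreathVec` serves this formula and the next: translations act diagonally
on the pair `(t, x)`, and coefficients act on `x` alone, independently of `t`. -/
theorem translationOp_wreathVec (g t : G) (x : ElementaryTensor G ξ) :
    translationOp (HilbertTensor G ξ) g (wreathVec t x) = wreathVec (g * t) (x.shift g) := by
  refine lp.ext (funext fun s => ?_)
  rw [translationOp_apply]
  by_cases h : s = g * t
  · subst h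
    rw [inv_mul_cancel_left, wreathVec_apply_self, wreathVec_apply_self]
    simp
  · rw [wreathVec_apply_ne _ h, wreathVec_apply_ne _ fun h' => h (by simp [← h'])]

theorem coeffOp_legOp_wreathVec (s t : G) (T : H →L[ℂ] H) (x : ElementaryTensor G ξ) :
    coeffOp (tensorShift G ξ) (legOp ξ s T) (wreathVec t x) = wreathVec t (x.leg s T) := by
  refine lp.ext (funext fun r => ?_)
  rw [coeffOp_apply]
  by_cases h : r = t
  · subst h
    rw [wreathVec_apply_self, wreathVec_apply_self, tensorShift_vec, ElementaryTensor.legOp_vec,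
      star_tensorShift_vec]
    simp
  · rw [wreathVec_apply_ne _ h, wreathVec_apply_ne _ h]
    simp

/-- The closed subspace spanned by the `δ_t ⊗ U_t⋆ x` with `t ∈ C` and `x` equal to `ξ` off `C`. -/
def wreathSpan (ξ : UnitVector H) (C : Set G) :
    Submodule ℂ (lp (fun _ : G => HilbertTensor G ξ) 2) :=
  (Submodule.span ℂ {v | ∃ t ∈ C, ∃ x : ElementaryTensor G ξ,
    (∀ r ∉ C, x.1 r = ξ) ∧ v = wreathVec t x}).topologicalClosure

theorem wreathVec_mem_wreathSpan {C : Set G} {t : G} (ht : t ∈ C) {x : ElementaryTensor G ξ}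
    (hx : ∀ r ∉ C, x.1 r = ξ) : wreathVec t x ∈ wreathSpan ξ C :=
  Submodule.le_topologicalClosure _ (Submodule.subset_span ⟨t, ht, x, hx, rfl⟩)

theorem wreathSpan_mono {C D : Set G} (h : C ⊆ D) : wreathSpan ξ C ≤ wreathSpan ξ D := by
  refine Submodule.topologicalClosure_mono (Submodule.span_mono ?_)
  rintro _ ⟨t, ht, x, hx, rfl⟩
  exact ⟨t, h ht, x, fun r hr => hx r fun hr' => hr (h hr'), rfl⟩

/-- Two continuous functionals (or operators) that agree on spanning vectors agree on the span. -/
theorem eqOn_wreathSpan {E : Type*} [NormedAddCommGroup E] [NormedSpace ℂ E] {C : Set G}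
    {f f' : lp (fun _ : G => HilbertTensor G ξ) 2 →L[ℂ] E}
    (h : ∀ t ∈ C, ∀ x : ElementaryTensor G ξ, (∀ r ∉ C, x.1 r = ξ) →
      f (wreathVec t x) = f' (wreathVec t x))
    {v : lp (fun _ : G => HilbertTensor G ξ) 2} (hv : v ∈ wreathSpan ξ C) : f v = f' v := by
  have hle : wreathSpan ξ C ≤ LinearMap.eqLocus f.toLinearMap f'.toLinearMap := by
    refine Submodule.topologicalClosure_minimal _ (Submodule.span_le.2 ?_)
      (isClosed_eq f.continuous f'.continuous)
    rintro _ ⟨t, ht, x, hx, rfl⟩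
    exact h t ht x hx
  exact hle hv

theorem inner_eqOn_wreathSpan {C : Set G} {B B' : lp (fun _ : G => HilbertTensor G ξ) 2 →L[ℂ]
      lp (fun _ : G => HilbertTensor G ξ) 2}
    (h : ∀ s ∈ C, ∀ y : ElementaryTensor G ξ, (∀ r ∉ C, y.1 r = ξ) →
      ∀ t ∈ C, ∀ x : ElementaryTensor G ξ, (∀ r ∉ C, x.1 r = ξ) →
      ⟪wreathVec s y, B (wreathVec t x)⟫_ℂ = ⟪wreathVec s y, B' (wreathVec t x)⟫_ℂ)
    {v w : lp (fun _ : G => HilbertTensor G ξ) 2} (hv : v ∈ wreathSpan ξ C)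
    (hw : w ∈ wreathSpan ξ C) : ⟪v, B w⟫_ℂ = ⟪v, B' w⟫_ℂ := by
  -- Conjugation turns the first slot into a linear one, so that both slots can be handled by
  -- `eqOn_wreathSpan` in turn.
  rw [← inner_conj_symm, ← inner_conj_symm v]
  congr 1
  refine eqOn_wreathSpan (f := innerSL ℂ (B w)) (f' := innerSL ℂ (B' w)) (fun s hs y hy => ?_) hv
  rw [innerSL_apply_apply, innerSL_apply_apply, ← inner_conj_symm, ← inner_conj_symm (B' w)]
  congr 1
  exact eqOn_wreathSpan (f := (innerSL ℂ (wreathVec s y)).comp B)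
    (f' := (innerSL ℂ (wreathVec s y)).comp B') (fun t ht x hx => h s hs y hy t ht x hx) hw

theorem span_wreathVec : (Submodule.span ℂ {v : lp (fun _ : G => HilbertTensor G ξ) 2 |
    ∃ t x, v = wreathVec t x}).topologicalClosure = ⊤ := by
  classical
  rw [Submodule.topologicalClosure_eq_top_iff, Submodule.eq_bot_iff]
  intro v hv
  refine lp.ext (funext fun t => ?_)
  have h (x : ElementaryTensor G ξ) : ⟪x.vec, v t⟫_ℂ = 0 := by
    -- Shifting by `t` cancels the twist, so the test vector is `δ_t ⊗ x`.
    have := hv (wreathVec t (x.shift t)) (Submodule.subset_span ⟨t, _, rfl⟩)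
    rwa [wreathVec, lp.inner_single_left, ElementaryTensor.shift_shift, inv_mul_cancel,
      ElementaryTensor.shift_one] at this
  have h0 : (Submodule.span ℂ (Set.range (ElementaryTensor.vec (ξ := ξ) (S := G))))ᗮ = ⊥ :=
    (Submodule.topologicalClosure_eq_top_iff).1 ElementaryTensor.span_vec
  have hm : v t ∈ (Submodule.span ℂ (Set.range (ElementaryTensor.vec (ξ := ξ) (S := G))))ᗮ := by
    rw [Submodule.mem_orthogonal]
    intro w hw
    induction hw using Submodule.span_induction with
    | mem w hw => obtain ⟨x, rfl⟩ := hw; exact h x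
    | zero => simp
    | add a b _ _ ha hb => rw [inner_add_left, ha, hb, add_zero]
    | smul c a _ ha => rw [inner_smul_left, ha, mul_zero]
  rw [h0] at hm
  exact hm

/-- Every vector has countable support. -/
theorem exists_countable_mem_wreathSpan (v : lp (fun _ : G => HilbertTensor G ξ) 2) :
    ∃ C : Set G, C.Countable ∧ v ∈ wreathSpan ξ C := by
  obtain ⟨s, hs, hsc, hv⟩ := Submodule.exists_countable_mem_topologicalClosure_span
    (span_wreathVec (ξ := ξ) (G := G) ▸ Submodule.mem_top (x := v))
  -- The choice is made for every vector, with an irrelevant default off `s`, so that `t` and `x` do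
  -- not depend on membership proofs.
  have hs' (w : lp (fun _ : G => HilbertTensor G ξ) 2) :
      ∃ (t : G) (x : ElementaryTensor G ξ), w ∈ s → w = wreathVec t x := by
    by_cases hw : w ∈ s
    · obtain ⟨t, x, h⟩ := hs hw
      exact ⟨t, x, fun _ => h⟩
    · exact ⟨1, ElementaryTensor.base ξ G, fun h => absurd h hw⟩
  choose t x htx using hs'
  refine ⟨⋃ w ∈ s, insert (t w) {r | (x w).1 r ≠ ξ},
    hsc.biUnion fun w _ => (x w).2.countable.insert _, ?_⟩
  refine Submodule.topologicalClosure_mono (Submodule.span_mono fun w hw => ?_) hv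
  refine ⟨t w, Set.mem_biUnion hw (Set.mem_insert _ _), x w, fun r hr => ?_, htx w hw⟩
  by_contra h
  exact hr (Set.mem_biUnion hw (Set.mem_insert_of_mem _ h))

end Vectors
/-! ## The generators of crossed products -/

section CrossedOps
variable {G : Type*} [Group G]
variable {K : Type*} [NormedAddCommGroup K] [InnerProductSpace ℂ K] [CompleteSpace K]

theorem translationOp_mul (g h : G) :
    translationOp K (g * h) = translationOp K g * translationOp K h := by
  refine ContinuousLinearMap.ext fun ζ => lp.ext (funext fun t => ?_)
  change ζ ((g * h)⁻¹ * t) = ζ (h⁻¹ * (g⁻¹ * t))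
  rw [mul_inv_rev, mul_assoc]

theorem translationOp_one : translationOp K (1 : G) = 1 := by
  refine ContinuousLinearMap.ext fun ζ => lp.ext (funext fun t => ?_)
  change ζ (1⁻¹ * t) = ζ t
  simp

theorem norm_translationOp_le (g : G) : ‖translationOp K g‖ ≤ 1 :=
  LinearMap.mkContinuous_norm_le _ zero_le_one _

theorem inner_translationOp (g : G) (ζ η : lp (fun _ : G => K) 2) :
    ⟪translationOp K g ζ, η⟫_ℂ = ⟪ζ, translationOp K g⁻¹ η⟫_ℂ := by
  rw [lp.inner_eq_tsum, lp.inner_eq_tsum, ← (Equiv.mulLeft g).tsum_eq]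
  refine tsum_congr fun t => ?_
  change ⟪ζ (g⁻¹ * (g * t)), η (g * t)⟫_ℂ = ⟪ζ t, η (g⁻¹⁻¹ * t)⟫_ℂ
  simp

theorem star_translationOp (g : G) : star (translationOp K g) = translationOp K g⁻¹ := by
  symm
  rw [ContinuousLinearMap.star_eq_adjoint, ContinuousLinearMap.eq_adjoint_iff]
  intro ζ η
  rw [inner_translationOp, inv_inv]

theorem inner_diagOp {T T' : G → K →L[ℂ] K} {C C' : ℝ} (hT : ∀ t, ‖T t‖ ≤ C)
    (hT' : ∀ t, ‖T' t‖ ≤ C') (h : ∀ t, star (T t) = T' t) (ζ η : lp (fun _ : G => K) 2) :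
    ⟪diagOp T C hT ζ, η⟫_ℂ = ⟪ζ, diagOp T' C' hT' η⟫_ℂ := by
  rw [lp.inner_eq_tsum, lp.inner_eq_tsum]
  refine tsum_congr fun t => ?_
  change ⟪T t (ζ t), η t⟫_ℂ = ⟪ζ t, T' t (η t)⟫_ℂ
  rw [← h, ContinuousLinearMap.star_eq_adjoint, ContinuousLinearMap.adjoint_inner_right]

theorem star_diagOp {T T' : G → K →L[ℂ] K} {C C' : ℝ} (hT : ∀ t, ‖T t‖ ≤ C)
    (hT' : ∀ t, ‖T' t‖ ≤ C') (h : ∀ t, star (T t) = T' t) :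
    star (diagOp T C hT) = diagOp T' C' hT' := by
  symm
  rw [ContinuousLinearMap.star_eq_adjoint, ContinuousLinearMap.eq_adjoint_iff]
  exact fun ζ η => inner_diagOp hT' hT (fun t => by rw [← h, star_star]) ζ η

/-- The representation `b ↦ π(b)` of the coefficients in a crossed product. -/
def coeffHom (U : G →* unitary (K →L[ℂ] K)) :
    (K →L[ℂ] K) →⋆ₐ[ℂ] (lp (fun _ : G => K) 2 →L[ℂ] lp (fun _ : G => K) 2) where
  toFun := coeffOp U
  map_one' := by
    refine ContinuousLinearMap.ext fun ζ => lp.ext (funext fun t => ?_)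
    change ((star (U t) : unitary (K →L[ℂ] K)) * 1 * (U t : K →L[ℂ] K)) (ζ t) = ζ t
    simp
  map_mul' a b := by
    refine ContinuousLinearMap.ext fun ζ => lp.ext (funext fun t => ?_)
    change ((star (U t) : unitary (K →L[ℂ] K)) * (a * b) * (U t : K →L[ℂ] K)) (ζ t) =
      ((star (U t) : unitary (K →L[ℂ] K)) * a * (U t : K →L[ℂ] K) *
        ((star (U t) : unitary (K →L[ℂ] K)) * b * (U t : K →L[ℂ] K))) (ζ t)
    congr 1
    have h : (U t : K →L[ℂ] K) * ((star (U t) : unitary (K →L[ℂ] K)) : K →L[ℂ] K) = 1 :=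
      Unitary.coe_mul_star_self (U t)
    simp only [mul_assoc]
    rw [← mul_assoc (U t : K →L[ℂ] K), h, one_mul]
  map_zero' := by
    refine ContinuousLinearMap.ext fun ζ => lp.ext (funext fun t => ?_)
    change ((star (U t) : unitary (K →L[ℂ] K)) * 0 * (U t : K →L[ℂ] K)) (ζ t) = 0
    simp
  map_add' a b := by
    refine ContinuousLinearMap.ext fun ζ => lp.ext (funext fun t => ?_)
    change ((star (U t) : unitary (K →L[ℂ] K)) * (a + b) * (U t : K →L[ℂ] K)) (ζ t) =
      ((star (U t) : unitary (K →L[ℂ] K)) * a * (U t : K →L[ℂ] K)) (ζ t) +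
        ((star (U t) : unitary (K →L[ℂ] K)) * b * (U t : K →L[ℂ] K)) (ζ t)
    rw [mul_add, add_mul]
    rfl
  commutes' c := by
    refine ContinuousLinearMap.ext fun ζ => lp.ext (funext fun t => ?_)
    change ((star (U t) : unitary (K →L[ℂ] K)) * (algebraMap ℂ (K →L[ℂ] K) c) *
      (U t : K →L[ℂ] K)) (ζ t) = c • ζ t
    have h : ((star (U t) : unitary (K →L[ℂ] K)) : K →L[ℂ] K) * (U t : K →L[ℂ] K) = 1 :=
      Unitary.coe_star_mul_self (U t)
    rw [← Algebra.commutes, mul_assoc, h, mul_one]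
    rfl
  map_star' a := by
    refine (star_diagOp _ _ fun t => ?_).symm
    simp [mul_assoc]

end CrossedOps

/-! ### Adjoints of the operators on single tensor factors. -/

section LegOps
variable {H : Type*} [NormedAddCommGroup H] [InnerProductSpace ℂ H] [CompleteSpace H]
variable {S : Type*} {ξ : UnitVector H}

theorem tensorKernel_leg (s : S) (T : H →L[ℂ] H) (x y : ElementaryTensor S ξ) :
    tensorKernel S ξ (x.leg s T) y = tensorKernel S ξ x (y.leg s (star T)) := by
  refine finprod_congr fun t => ?_
  by_cases h : t = s
  · subst h
    rw [ElementaryTensor.leg_apply_self, ElementaryTensor.leg_apply_self,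
      ContinuousLinearMap.star_eq_adjoint, ContinuousLinearMap.adjoint_inner_right]
  · rw [ElementaryTensor.leg_apply_ne _ _ h, ElementaryTensor.leg_apply_ne _ _ h]

theorem star_legOp (s : S) (T : H →L[ℂ] H) : star (legOp ξ s T) = legOp ξ s (star T) := by
  refine HilbertTensor.clm_ext fun y => ?_
  refine ext_inner_left ℂ fun v => ?_
  rw [ContinuousLinearMap.star_eq_adjoint, ContinuousLinearMap.adjoint_inner_right]
  have h : ((innerSL ℂ y.vec).comp (legOp ξ s T)) = innerSL ℂ (legOp ξ s (star T) y.vec) := by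
    refine HilbertTensor.clm_ext fun x => ?_
    simp only [ContinuousLinearMap.comp_apply, innerSL_apply_apply, ElementaryTensor.legOp_vec,
      ElementaryTensor.inner_vec]
    rw [tensorKernel_leg, star_star]
  have h1 := congrArg (starRingEnd ℂ) (congrArg (fun f => f v) h)
  simpa using h1

end LegOps

/-! ## Matrix coefficients of conjugates -/

section Coefficients
variable {A : Type*} [CStarAlgebra A]
variable {H : Type*} [NormedAddCommGroup H] [InnerProductSpace ℂ H] [CompleteSpace H]
variable {G : Type*} [Group G]

/-- The Hilbert space `ℓ²(G, ⨂_G (H, ξ))`. -/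
abbrev WreathSpace (G : Type*) (ξ : UnitVector H) : Type _ :=
  lp (fun _ : G => HilbertTensor G ξ) 2

/-- The C⋆-subalgebra generated by the tensor factors and the translations indexed by `C`. -/
def wreathSubalgebra (π : A →⋆ₐ[ℂ] (H →L[ℂ] H)) (ξ : UnitVector H) (C : Set G) :
    StarSubalgebra ℂ (WreathSpace G ξ →L[ℂ] WreathSpace G ξ) :=
  (StarAlgebra.adjoin ℂ
    ({T | ∃ s ∈ C, ∃ a, T = coeffOp (tensorShift G ξ) (legOp ξ s (π a))} ∪
      translationOp (HilbertTensor G ξ) '' C)).topologicalClosure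

variable {π : A →⋆ₐ[ℂ] (H →L[ℂ] H)} {ξ : UnitVector H}

theorem wreathSubalgebra_mono {C D : Set G} (h : C ⊆ D) :
    wreathSubalgebra π ξ C ≤ wreathSubalgebra π ξ D := by
  refine StarSubalgebra.topologicalClosure_mono (StarAlgebra.adjoin_mono ?_)
  refine Set.union_subset_union ?_ (Set.image_mono h)
  rintro _ ⟨s, hs, a, rfl⟩
  exact ⟨s, h hs, a, rfl⟩

/-- The operators that lie in the C⋆-algebra of some countable subset of `G`. -/
def countablySupported (π : A →⋆ₐ[ℂ] (H →L[ℂ] H)) (ξ : UnitVector H) (G : Type*) [Group G] :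
    StarSubalgebra ℂ (WreathSpace G ξ →L[ℂ] WreathSpace G ξ) where
  carrier := {T | ∃ C : Set G, C.Countable ∧ T ∈ wreathSubalgebra π ξ C}
  mul_mem' := by
    rintro T T' ⟨C, hC, hT⟩ ⟨D, hD, hT'⟩
    exact ⟨C ∪ D, hC.union hD, mul_mem (wreathSubalgebra_mono Set.subset_union_left hT)
      (wreathSubalgebra_mono Set.subset_union_right hT')⟩
  add_mem' := by
    rintro T T' ⟨C, hC, hT⟩ ⟨D, hD, hT'⟩
    exact ⟨C ∪ D, hC.union hD, add_mem (wreathSubalgebra_mono Set.subset_union_left hT)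
      (wreathSubalgebra_mono Set.subset_union_right hT')⟩
  algebraMap_mem' c := ⟨∅, Set.countable_empty, algebraMap_mem _ c⟩
  star_mem' := by
    rintro T ⟨C, hC, hT⟩
    exact ⟨C, hC, star_mem hT⟩

/-- Norm limits can be taken along sequences, and a countable union of countable sets is countable.
-/
theorem isClosed_countablySupported : IsClosed (countablySupported π ξ G :
    Set (WreathSpace G ξ →L[ℂ] WreathSpace G ξ)) := by
  refine IsSeqClosed.isClosed fun f T hf hlim => ?_
  choose C hC hfC using hf
  exact ⟨⋃ n, C n, Set.countable_iUnion hC,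
    (StarSubalgebra.isClosed_topologicalClosure _).mem_of_tendsto hlim
      (Eventually.of_forall fun n => wreathSubalgebra_mono (Set.subset_iUnion C n) (hfC n))⟩

/-- Each generator involves one element of `G`. The closure inside the minimal tensor product is
handled by pulling the closed set back along the continuous `coeffHom`. -/
theorem cstarWreath_le_countablySupported : cstarWreath π ξ G ≤ countablySupported π ξ G := by
  refine StarSubalgebra.topologicalClosure_minimal (StarAlgebra.adjoin_le ?_)
    isClosed_countablySupported
  rintro _ (⟨b, hb, rfl⟩ | ⟨g, rfl⟩)
  · have hle : minTensor π ξ G ≤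
        (countablySupported π ξ G).comap (coeffHom (tensorShift G ξ)) := by
      refine StarSubalgebra.topologicalClosure_minimal (StarAlgebra.adjoin_le ?_)
        (isClosed_countablySupported.preimage (map_continuous (coeffHom (tensorShift G ξ))))
      rintro _ ⟨s, a, rfl⟩
      exact ⟨{s}, Set.countable_singleton s, StarSubalgebra.le_topologicalClosure _
        (StarAlgebra.subset_adjoin ℂ _ (Or.inl ⟨s, rfl, a, rfl⟩))⟩
    exact hle hb
  · exact ⟨{g}, Set.countable_singleton g, StarSubalgebra.le_topologicalClosure _
      (StarAlgebra.subset_adjoin ℂ _ (Or.inr ⟨g, rfl, rfl⟩))⟩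

/-- The closed span of the pairs `(e(h, z), e(h q, z ⊔ h x))` with `h ∈ Λ` and `z` supported in `Λ`,
where `z ⊔ h x` is `z` on `Λ` and the shift of `x` off `Λ`. -/
def amplifiedSpan (Λ : Subgroup G) (q : G) (x : ElementaryTensor G ξ) :
    Submodule ℂ (WreathSpace G ξ × WreathSpace G ξ) :=
  (Submodule.span ℂ {v | ∃ h ∈ Λ, ∃ z z' : ElementaryTensor G ξ, (∀ r ∉ Λ, z.1 r = ξ) ∧
    (∀ r ∈ Λ, z'.1 r = z.1 r) ∧ (∀ r ∉ Λ, z'.1 r = x.1 (h⁻¹ * r)) ∧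
    v = (wreathVec h z, wreathVec (h * q) z')}).topologicalClosure

/-- The operators `T` such that `T ⊕ T` leaves a closed subspace invariant. -/
def invariantSubalgebra {E : Type*} [NormedAddCommGroup E] [InnerProductSpace ℂ E]
    (L : Submodule ℂ (E × E)) : Subalgebra ℂ (E →L[ℂ] E) where
  carrier := {T | ∀ v ∈ L, (T v.1, T v.2) ∈ L}
  mul_mem' hS hT v hv := hS _ (hT v hv)
  add_mem' hS hT v hv := L.add_mem (hS v hv) (hT v hv)
  algebraMap_mem' c _ hv := L.smul_mem c hv

theorem isClosed_invariantSubalgebra {E : Type*} [NormedAddCommGroup E] [InnerProductSpace ℂ E]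
    {L : Submodule ℂ (E × E)} (hL : IsClosed (L : Set (E × E))) :
    IsClosed (invariantSubalgebra L : Set (E →L[ℂ] E)) := by
  have : (invariantSubalgebra L : Set (E →L[ℂ] E)) =
      ⋂ v ∈ L, (fun T : E →L[ℂ] E => (T v.1, T v.2)) ⁻¹' (L : Set (E × E)) := by
    ext T
    simp [invariantSubalgebra]
  rw [this]
  exact isClosed_biInter fun v _ => hL.preimage (by fun_prop)

theorem mem_invariantSubalgebra_of_span {E : Type*} [NormedAddCommGroup E] [InnerProductSpace ℂ E]
    {s : Set (E × E)} {T : E →L[ℂ] E} (h : ∀ v ∈ s, (T v.1, T v.2) ∈ s) :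
    T ∈ invariantSubalgebra (Submodule.span ℂ s).topologicalClosure := by
  have hle : (Submodule.span ℂ s).topologicalClosure ≤
      ((Submodule.span ℂ s).topologicalClosure).comap (T.prodMap T).toLinearMap := by
    refine Submodule.topologicalClosure_minimal _ (Submodule.span_le.2 fun v hv => ?_)
      ((Submodule.isClosed_topologicalClosure _).preimage (T.prodMap T).continuous)
    exact Submodule.le_topologicalClosure _ (Submodule.subset_span (h v hv))
  exact fun v hv => hle hv

/-- A factor operator at `s ∈ Λ` changes `z` and `z'` in the same way and ignores the coordinates
off `Λ`; a translation by `g ∈ Λ` preserves `Λ` and its complement and replaces `h` by `g h`. So the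
operators supported in `Λ` act on the second component as they do on the first. -/
theorem wreathSubalgebra_le_invariantSubalgebra {Λ : Subgroup G} {q : G}
    {x : ElementaryTensor G ξ} {T : WreathSpace G ξ →L[ℂ] WreathSpace G ξ}
    (hT : T ∈ wreathSubalgebra π ξ (Λ : Set G)) :
    T ∈ invariantSubalgebra (amplifiedSpan Λ q x) := by
  -- An arbitrary `b` is allowed, so that adjoints of generators are covered too.
  have hleg (s : G) (hs : s ∈ Λ) (b : H →L[ℂ] H) : coeffOp (tensorShift G ξ) (legOp ξ s b) ∈
      invariantSubalgebra (amplifiedSpan Λ q x) := by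
    refine mem_invariantSubalgebra_of_span ?_
    rintro _ ⟨h, hh, z, z', hz, h1, h2, rfl⟩
    have hne {r : G} (hr : r ∉ Λ) : r ≠ s := fun h => hr (h ▸ hs)
    refine ⟨h, hh, z.leg s b, z'.leg s b, fun r hr => ?_, fun r hr => ?_, fun r hr => ?_, ?_⟩
    · rw [ElementaryTensor.leg_apply_ne _ _ (hne hr), hz r hr]
    · by_cases hrs : r = s
      · subst hrs
        rw [ElementaryTensor.leg_apply_self, ElementaryTensor.leg_apply_self, h1 r hr]
      · rw [ElementaryTensor.leg_apply_ne _ _ hrs, ElementaryTensor.leg_apply_ne _ _ hrs, h1 r hr]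
    · rw [ElementaryTensor.leg_apply_ne _ _ (hne hr), h2 r hr]
    · rw [coeffOp_legOp_wreathVec, coeffOp_legOp_wreathVec]
  have htr (g : G) (hg : g ∈ Λ) : translationOp (HilbertTensor G ξ) g ∈
      invariantSubalgebra (amplifiedSpan Λ q x) := by
    refine mem_invariantSubalgebra_of_span ?_
    rintro _ ⟨h, hh, z, z', hz, h1, h2, rfl⟩
    have hiff (r : G) : g⁻¹ * r ∈ Λ ↔ r ∈ Λ := Λ.mul_mem_cancel_left (Λ.inv_mem hg)
    refine ⟨g * h, Λ.mul_mem hg hh, z.shift g, z'.shift g, fun r hr => hz _ fun h => hr ((hiff r).1 h),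
      fun r hr => h1 _ ((hiff r).2 hr), fun r hr => ?_, ?_⟩
    · rw [ElementaryTensor.shift_apply, h2 _ (by rwa [hiff]), mul_inv_rev, mul_assoc]
    · rw [translationOp_wreathVec, translationOp_wreathVec, mul_assoc]
  have hcl : IsClosed (invariantSubalgebra (amplifiedSpan Λ q x) :
      Set (WreathSpace G ξ →L[ℂ] WreathSpace G ξ)) :=
    isClosed_invariantSubalgebra (Submodule.isClosed_topologicalClosure _)
  -- Invariance of a subspace is not stable under adjoints, so the star algebra is viewed as the
  -- plain algebra generated by the generators and their adjoints.
  refine closure_minimal (fun T hT => ?_) hcl hT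
  have hT : T ∈ (StarAlgebra.adjoin ℂ _).toSubalgebra := hT
  rw [StarAlgebra.adjoin_toSubalgebra] at hT
  refine Algebra.adjoin_le ?_ hT
  rintro T ((⟨s, hs, a, rfl⟩ | ⟨g, hg, rfl⟩) | h)
  · exact hleg s hs _
  · exact htr g hg
  · rw [Set.mem_star] at h
    obtain ⟨s, hs, a, h⟩ | ⟨g, hg, h⟩ := h
    · rw [← star_star T, h]
      have : star (coeffOp (tensorShift G ξ) (legOp ξ s (π a))) =
          coeffOp (tensorShift G ξ) (legOp ξ s (star (π a))) := by
        rw [← star_legOp]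
        exact (map_star (coeffHom (tensorShift G ξ)) _).symm
      rw [this]
      exact hleg s hs _
    · rw [← star_star T, ← h, star_translationOp]
      exact htr _ (Λ.inv_mem hg)

variable (G ξ) in
/-- The vector `Ω = δ_1 ⊗ ⨂ ξ`. -/
def vacuum : WreathSpace G ξ := wreathVec 1 (ElementaryTensor.base ξ G)

theorem tensorKernel_mul_of_eq {x y z w x' y' : ElementaryTensor G ξ}
    (h : ∀ r, ⟪x.1 r, y.1 r⟫_ℂ = ⟪z.1 r, w.1 r⟫_ℂ * ⟪x'.1 r, y'.1 r⟫_ℂ) :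
    tensorKernel G ξ x y = tensorKernel G ξ z w * tensorKernel G ξ x' y' := by
  have hfin (x y : ElementaryTensor G ξ) :
      (Function.mulSupport fun r => ⟪x.1 r, y.1 r⟫_ℂ).Finite := by
    refine (x.2.union y.2).subset fun r hr => ?_
    by_contra hn
    simp only [Set.mem_union, Set.mem_ofPred_eq, not_or, not_not] at hn
    exact hr (by simp only [hn.1, hn.2, UnitVector.inner_self])
  rw [tensorKernel, tensorKernel, tensorKernel, ← finprod_mul_distrib (hfin _ _) (hfin _ _)]
  exact finprod_congr h

/-- The pair `(Ω, e(q, x))` lies in `amplifiedSpan`, hence so does `(T Ω, T e(q, x))`. It remains to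
compare two continuous functionals on spanning pairs, where `T` no longer appears. -/
theorem inner_wreathVec_apply_of_disjoint {Λ : Subgroup G} {p q : G} (hpq : p * q⁻¹ ∈ Λ → p = q)
    {x y : ElementaryTensor G ξ} (hx : ∀ r ∈ Λ, x.1 r = ξ) (hy : ∀ r ∈ Λ, y.1 r = ξ)
    {T : WreathSpace G ξ →L[ℂ] WreathSpace G ξ} (hT : T ∈ wreathSubalgebra π ξ (Λ : Set G)) :
    ⟪wreathVec p y, T (wreathVec q x)⟫_ℂ =
      ⟪vacuum G ξ, T (vacuum G ξ)⟫_ℂ * ⟪wreathVec p y, wreathVec q x⟫_ℂ := by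
  have hmem : (vacuum G ξ, wreathVec q x) ∈ amplifiedSpan Λ q x :=
    Submodule.le_topologicalClosure _ (Submodule.subset_span ⟨1, Λ.one_mem,
      ElementaryTensor.base ξ G, x,
      fun r _ => rfl, fun r hr => hx r hr, fun r _ => by simp, by simp [vacuum]⟩)
  have hTm := wreathSubalgebra_le_invariantSubalgebra (q := q) (x := x) hT _ hmem
  let f : WreathSpace G ξ × WreathSpace G ξ →L[ℂ] ℂ :=
    (innerSL ℂ (wreathVec p y)).comp (ContinuousLinearMap.snd ℂ _ _)
  let f' : WreathSpace G ξ × WreathSpace G ξ →L[ℂ] ℂ :=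
    ⟪wreathVec p y, wreathVec q x⟫_ℂ • (innerSL ℂ (vacuum G ξ)).comp (ContinuousLinearMap.fst ℂ _ _)
  have hle : amplifiedSpan Λ q x ≤ LinearMap.eqLocus f.toLinearMap f'.toLinearMap := by
    refine Submodule.topologicalClosure_minimal _ (Submodule.span_le.2 ?_)
      (isClosed_eq f.continuous f'.continuous)
    rintro _ ⟨h, hh, z, z', hz, h1, h2, rfl⟩
    change ⟪wreathVec p y, wreathVec (h * q) z'⟫_ℂ =
      ⟪wreathVec p y, wreathVec q x⟫_ℂ * ⟪vacuum G ξ, wreathVec h z⟫_ℂ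
    -- If `p = h q`, then `p q⁻¹ = h ∈ Λ` forces `p = q` and `h = 1`, and the kernel splits into its
    -- parts over `Λ` and off `Λ`. Otherwise both sides vanish.
    by_cases hp : p = h * q
    · have hpq' : p = q := hpq (by rw [hp]; simpa using hh)
      have h1' : h = 1 := by simpa [hpq'] using hp
      subst h1'
      subst hpq'
      rw [one_mul, vacuum, inner_wreathVec_self, inner_wreathVec_self, inner_wreathVec_self]
      refine tensorKernel_mul_of_eq fun r => ?_
      by_cases hr : r ∈ Λ
      · rw [h1 r hr, hy r hr, hx r hr, UnitVector.inner_self, one_mul]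
        rfl
      · rw [h2 r hr, hz r hr, ElementaryTensor.base_apply, UnitVector.inner_self, mul_one, inv_one,
          one_mul]
    · rw [inner_wreathVec_ne hp]
      by_cases hpq' : p = q
      · have : 1 ≠ h := fun h' => hp (by simp [← h', hpq'])
        rw [vacuum, inner_wreathVec_ne this, mul_zero]
      · rw [inner_wreathVec_ne hpq', zero_mul]
  have := hle hTm
  exact Eq.trans this (mul_comm _ _)

/-- On vectors supported in `Λ`, the conjugate of an operator supported in `Λ` by a translation that
moves `Λ` off itself acts as a scalar. -/
theorem inner_conj_translationOp {Λ : Subgroup G} {g : G} (hg : g ∉ Λ)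
    (hfree : ∀ h ∈ Λ, g⁻¹ * h * g ∈ Λ → h = 1) {T : WreathSpace G ξ →L[ℂ] WreathSpace G ξ}
    (hT : T ∈ wreathSubalgebra π ξ (Λ : Set G)) {v w : WreathSpace G ξ}
    (hv : v ∈ wreathSpan ξ (Λ : Set G)) (hw : w ∈ wreathSpan ξ (Λ : Set G)) :
    ⟪v, (translationOp (HilbertTensor G ξ) g * T * translationOp (HilbertTensor G ξ) g⁻¹) w⟫_ℂ =
      ⟪vacuum G ξ, T (vacuum G ξ)⟫_ℂ * ⟪v, w⟫_ℂ := by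
  set c := ⟪vacuum G ξ, T (vacuum G ξ)⟫_ℂ
  set B := translationOp (HilbertTensor G ξ) g * T * translationOp (HilbertTensor G ξ) g⁻¹ with hB
  have hinv {r : G} (hr : r ∈ Λ) : g * r ∉ Λ := fun h => hg ((Λ.mul_mem_cancel_right hr).1 h)
  have h := inner_eqOn_wreathSpan (B := B) (B' := c • 1) (fun s hs y hy t ht x hx => ?_) hv hw
  · rw [h, smul_apply, one_apply_eq_self, inner_smul_right]
  change ⟪wreathVec s y, translationOp (HilbertTensor G ξ) g
    (T (translationOp (HilbertTensor G ξ) g⁻¹ (wreathVec t x)))⟫_ℂ =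
      ⟪wreathVec s y, c • wreathVec t x⟫_ℂ
  have h1 := inner_translationOp g⁻¹ (wreathVec s y)
    (T (translationOp (HilbertTensor G ξ) g⁻¹ (wreathVec t x)))
  rw [inv_inv] at h1
  -- Moving `λ_g` to the left slot gives `p = g⁻¹ s` and `q = g⁻¹ t`, with `p q⁻¹ = g⁻¹ (s t⁻¹) g`:
  -- freeness gives `s = t`. The shifted tensors equal `ξ` on `Λ` because `g Λ` misses `Λ`.
  rw [inner_smul_right, ← h1, translationOp_wreathVec, translationOp_wreathVec,
    inner_wreathVec_apply_of_disjoint (fun h => ?_) (fun r hr => ?_) (fun r hr => ?_) hT,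
    ← translationOp_wreathVec, ← translationOp_wreathVec, inner_translationOp,
    ← mul_apply_eq_comp, ← translationOp_mul, inv_inv, mul_inv_cancel, translationOp_one,
    one_apply_eq_self]
  · have h2 := hfree (s * t⁻¹) (Λ.mul_mem hs (Λ.inv_mem ht)) (by simpa [mul_assoc] using h)
    rw [mul_inv_eq_one.1 h2]
  · simpa using hx _ (hinv hr)
  · simpa using hy _ (hinv hr)

end Coefficients

/-! ## Central sequences in C⋆-wreath products -/

/-- A single unitary `λ_g` of the algebra controls all distances `‖x_n - c_n‖` at once, because all
the relevant supports are countable. -/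
theorem HasFreeConjugators.noNontrivialCentralSequences_cstarWreath {A : Type*} [CStarAlgebra A]
    {H : Type*} [NormedAddCommGroup H] [InnerProductSpace ℂ H] [CompleteSpace H]
    {G : Type*} [Group G] (hG : HasFreeConjugators G) (π : A →⋆ₐ[ℂ] (H →L[ℂ] H))
    (ξ : UnitVector H) : NoNontrivialCentralSequences (cstarWreath π ξ G) := by
  intro x _ hx
  let X (n : ℕ) : WreathSpace G ξ →L[ℂ] WreathSpace G ξ := x n
  let c (n : ℕ) : ℂ := ⟪vacuum G ξ, X n (vacuum G ξ)⟫_ℂ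
  let z (n : ℕ) : WreathSpace G ξ →L[ℂ] WreathSpace G ξ := X n - algebraMap ℂ _ (c n)
  -- The norm need not be attained; any factor larger than `1` would serve in place of `2`.
  have hw (n : ℕ) : ∃ w : WreathSpace G ξ, ‖w‖ ≤ 1 ∧ ‖z n‖ ≤ 2 * ‖z n w‖ := by
    rcases (norm_nonneg (z n)).eq_or_lt with h | h
    · exact ⟨0, by simp, by rw [← h]; positivity⟩
    · obtain ⟨w, hw1, hw2⟩ := (z n).exists_lt_apply_of_lt_opNorm (half_lt_self h)
      exact ⟨w, hw1.le, by linarith⟩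
  choose w hw1 hw2 using hw
  choose C hC hXC using fun n => cstarWreath_le_countablySupported (x n).2
  choose D hD hwD using fun n => exists_countable_mem_wreathSpan (w n)
  choose E hE hzE using fun n => exists_countable_mem_wreathSpan (z n (w n))
  obtain ⟨Λ, hΛ, g, hg, hfree⟩ := hG (⋃ n, (C n ∪ D n ∪ E n))
    (Set.countable_iUnion fun n => ((hC n).union (hD n)).union (hE n))
  have hsub (n : ℕ) : C n ∪ D n ∪ E n ⊆ Λ := (Set.subset_iUnion _ n).trans hΛ
  let u : WreathSpace G ξ →L[ℂ] WreathSpace G ξ := translationOp (HilbertTensor G ξ) g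
  have hu : u ∈ cstarWreath π ξ G := StarSubalgebra.le_topologicalClosure _
    (StarAlgebra.subset_adjoin ℂ _ (Or.inr ⟨g, rfl⟩))
  have hbound (n : ℕ) : ‖z n‖ ≤ 2 * ‖X n * u - u * X n‖ := by
    set v := z n (w n) with hv
    have hmX := wreathSubalgebra_mono
      ((Set.subset_union_left.trans Set.subset_union_left).trans (hsub n)) (hXC n)
    have hmw := wreathSpan_mono
      ((Set.subset_union_right.trans Set.subset_union_left).trans (hsub n)) (hwD n)
    have hmv := wreathSpan_mono (Set.subset_union_right.trans (hsub n)) (hzE n)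
    have h1 := inner_conj_translationOp hg hfree hmX hmv hmw
    have h2 : u * translationOp (HilbertTensor G ξ) g⁻¹ = 1 := by
      rw [← translationOp_mul, mul_inv_cancel, translationOp_one]
    -- Since `[x_n, u] u⁻¹ = x_n - u x_n u⁻¹` and the second term acts as `c_n` between `v` and
    -- `w_n`, what remains is `⟪v, (x_n - c_n) w_n⟫ = ⟪v, v⟫`.
    have h3 : ⟪v, ((X n * u - u * X n) * translationOp (HilbertTensor G ξ) g⁻¹) (w n)⟫_ℂ =
        ⟪v, v⟫_ℂ := by
      have : (X n * u - u * X n) * translationOp (HilbertTensor G ξ) g⁻¹ =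
          X n - u * X n * translationOp (HilbertTensor G ξ) g⁻¹ := by
        rw [sub_mul, mul_assoc (X n), h2, mul_one]
      rw [this, sub_apply, inner_sub_right]
      change _ - ⟪v, (translationOp (HilbertTensor G ξ) g * X n *
        translationOp (HilbertTensor G ξ) g⁻¹) (w n)⟫_ℂ = _
      rw [h1, hv]
      change _ = ⟪z n (w n), X n (w n) - c n • w n⟫_ℂ
      rw [inner_sub_right, inner_smul_right]
    have h4 : ‖v‖ ^ 2 ≤ ‖v‖ * ‖X n * u - u * X n‖ := by
      rw [← @inner_self_eq_norm_sq ℂ, ← h3]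
      refine (RCLike.re_le_norm _).trans ((norm_inner_le_norm _ _).trans ?_)
      gcongr
      refine (ContinuousLinearMap.le_opNorm _ _).trans ?_
      refine (mul_le_of_le_one_right (norm_nonneg _) (hw1 n)).trans ?_
      exact (norm_mul_le _ _).trans
        (mul_le_of_le_one_right (norm_nonneg _) (norm_translationOp_le _))
    have h5 : ‖v‖ ≤ ‖X n * u - u * X n‖ := by
      rcases (norm_nonneg v).eq_or_lt with h | h
      · rw [← h]; positivity
      · rw [sq] at h4
        exact le_of_mul_le_mul_left h4 h
    linarith [hw2 n]
  refine ⟨c, squeeze_zero (fun n => norm_nonneg _) (fun n => hbound n) ?_⟩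
  have := (hx ⟨u, hu⟩).const_mul 2
  rw [mul_zero] at this
  exact this
/-! ## The commutant of a von Neumann wreath product -/

/-- One commutation relation suffices, since the centralizer is closed under adjoints. -/
theorem VonNeumannAlgebra.mem_generate_iff {K : Type*} [NormedAddCommGroup K]
    [InnerProductSpace ℂ K] [CompleteSpace K] {s : Set (K →L[ℂ] K)} {T : K →L[ℂ] K} :
    T ∈ VonNeumannAlgebra.generate s ↔ ∀ R ∈ StarSubalgebra.centralizer ℂ s, R * T = T * R := by
  change T ∈ StarSubalgebra.centralizer ℂ
    (StarSubalgebra.centralizer ℂ s : Set (K →L[ℂ] K)) ↔ _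
  rw [StarSubalgebra.mem_centralizer_iff]
  exact ⟨fun h R hR => (h R hR).1, fun h R hR => ⟨h R hR, h _ (star_mem hR)⟩⟩

theorem VonNeumannAlgebra.subset_generate {K : Type*} [NormedAddCommGroup K]
    [InnerProductSpace ℂ K] [CompleteSpace K] {s : Set (K →L[ℂ] K)} {T : K →L[ℂ] K} (hT : T ∈ s) :
    T ∈ VonNeumannAlgebra.generate s :=
  VonNeumannAlgebra.mem_generate_iff.2 fun _ hR =>
    ((StarSubalgebra.mem_centralizer_iff ℂ).1 hR T hT).1.symm

section RightOp
variable {G : Type*} [Group G]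
variable {K : Type*} [NormedAddCommGroup K] [InnerProductSpace ℂ K] [CompleteSpace K]

/-- The right translation `ζ ↦ (t ↦ ζ(t s))` on `ℓ²(G, K)`. -/
def rightTranslationOp (K : Type*) [NormedAddCommGroup K] [InnerProductSpace ℂ K]
    [CompleteSpace K] (s : G) :
    lp (fun _ : G => K) 2 →L[ℂ] lp (fun _ : G => K) 2 :=
  LinearMap.mkContinuous
    { toFun := fun ζ => ⟨fun t => ζ (t * s), memℓp_two_of_summable
        (((Equiv.mulRight s).summable_iff (f := fun t => ‖ζ t‖ ^ 2)).2 (summable_sq_of_lp ζ))⟩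
      map_add' := fun ζ η => by ext t; simp; rfl
      map_smul' := fun c ζ => by ext t; simp } 1 fun ζ => by
    rw [one_mul, ← sq_le_sq₀ (by positivity) (by positivity), lp_norm_sq, lp_norm_sq]
    exact ((Equiv.mulRight s).tsum_eq fun t => ‖ζ t‖ ^ 2).le

/-- The twisted right translation `(ρ_s ζ)(t) = U_s ζ(t s)` on `ℓ²(G, K)`. -/
def rightOp (U : G →* unitary (K →L[ℂ] K)) (s : G) :
    lp (fun _ : G => K) 2 →L[ℂ] lp (fun _ : G => K) 2 :=
  diagOp (fun _ => (U s : K →L[ℂ] K)) ‖(U s : K →L[ℂ] K)‖ (fun _ => le_rfl) *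
    rightTranslationOp K s

theorem translationOp_mul_rightOp (U : G →* unitary (K →L[ℂ] K)) (g s : G) :
    translationOp K g * rightOp U s = rightOp U s * translationOp K g := by
  refine ContinuousLinearMap.ext fun ζ => lp.ext (funext fun t => ?_)
  change (U s : K →L[ℂ] K) (ζ (g⁻¹ * t * s)) = (U s : K →L[ℂ] K) (ζ (g⁻¹ * (t * s)))
  rw [mul_assoc]

theorem coeffOp_mul_rightOp (U : G →* unitary (K →L[ℂ] K)) (b : K →L[ℂ] K) (s : G) :
    coeffOp U b * rightOp U s = rightOp U s * coeffOp U b := by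
  refine ContinuousLinearMap.ext fun ζ => lp.ext (funext fun t => ?_)
  change (((star (U t) : unitary (K →L[ℂ] K)) : K →L[ℂ] K) * b * (U t : K →L[ℂ] K) *
      (U s : K →L[ℂ] K)) (ζ (t * s)) =
    ((U s : K →L[ℂ] K) * (((star (U (t * s)) : unitary (K →L[ℂ] K)) : K →L[ℂ] K) * b *
      (U (t * s) : K →L[ℂ] K))) (ζ (t * s))
  congr 1
  -- The twist by `U_s` compensates the change of base point from `t` to `t s`: `U_s U_{ts}⋆ =
  -- U_t⋆`.
  have h : (U s : K →L[ℂ] K) * ((star (U (t * s)) : unitary (K →L[ℂ] K)) : K →L[ℂ] K) =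
      ((star (U t) : unitary (K →L[ℂ] K)) : K →L[ℂ] K) := by
    rw [← Submonoid.coe_mul, Unitary.star_eq_inv, Unitary.star_eq_inv, map_mul, mul_inv_rev,
      mul_inv_cancel_left]
  rw [← mul_assoc, ← mul_assoc, h, map_mul, Submonoid.coe_mul, mul_assoc, mul_assoc]

theorem translationOp_mul_diagOp_const (g : G) (c : K →L[ℂ] K) :
    translationOp K g * diagOp (fun _ : G => c) ‖c‖ (fun _ => le_rfl) =
      diagOp (fun _ : G => c) ‖c‖ (fun _ => le_rfl) * translationOp K g := by
  refine ContinuousLinearMap.ext fun ζ => lp.ext (funext fun t => ?_)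
  change c (ζ (g⁻¹ * t)) = c (ζ (g⁻¹ * t))
  rfl

/-- At the coordinate `t` the coefficient is `U_t⋆ b U_t`; it commutes with `c` exactly when `b`
commutes with `U_t c U_t⋆`. -/
theorem coeffOp_mul_diagOp_const (U : G →* unitary (K →L[ℂ] K)) {b c : K →L[ℂ] K}
    (h : ∀ t, b * ((U t : K →L[ℂ] K) * c * ((star (U t) : unitary (K →L[ℂ] K)) : K →L[ℂ] K)) =
      (U t : K →L[ℂ] K) * c * ((star (U t) : unitary (K →L[ℂ] K)) : K →L[ℂ] K) * b) :
    coeffOp U b * diagOp (fun _ : G => c) ‖c‖ (fun _ => le_rfl) =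
      diagOp (fun _ : G => c) ‖c‖ (fun _ => le_rfl) * coeffOp U b := by
  refine ContinuousLinearMap.ext fun ζ => lp.ext (funext fun t => ?_)
  change (((star (U t) : unitary (K →L[ℂ] K)) : K →L[ℂ] K) * b * (U t : K →L[ℂ] K) * c) (ζ t) =
    (c * (((star (U t) : unitary (K →L[ℂ] K)) : K →L[ℂ] K) * b * (U t : K →L[ℂ] K))) (ζ t)
  congr 1
  set V : K →L[ℂ] K := (U t : K →L[ℂ] K)
  set W : K →L[ℂ] K := ((star (U t) : unitary (K →L[ℂ] K)) : K →L[ℂ] K)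
  have h1 : W * V = 1 := Unitary.coe_star_mul_self (U t)
  calc W * b * V * c = W * (b * (V * c * W)) * V := by
        simp only [mul_assoc]; rw [h1, mul_one]
    _ = W * (V * c * W * b) * V := by rw [h t]
    _ = c * (W * b * V) := by
        simp only [← mul_assoc]; rw [h1, one_mul]

end RightOp

/-! ### Linearity, continuity and commutation of operators on tensor factors. -/

section LegLinear
variable {H : Type*} [NormedAddCommGroup H] [InnerProductSpace ℂ H] [CompleteSpace H]
variable {S : Type*} {ξ : UnitVector H}

theorem HilbertTensor.ext_inner_vec {v w : HilbertTensor S ξ}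
    (h : ∀ x : ElementaryTensor S ξ, ⟪x.vec, v⟫_ℂ = ⟪x.vec, w⟫_ℂ) : v = w := by
  have : innerSL ℂ v = innerSL ℂ w := HilbertTensor.clm_ext fun x => by
    rw [innerSL_apply_apply, innerSL_apply_apply, ← inner_conj_symm, h, inner_conj_symm]
  refine ext_inner_right ℂ fun u => ?_
  exact congrArg (fun f => f u) this

-- The dependence on `T` is isolated in one factor, which makes `legOp` visibly linear in `T`.
open Classical in
theorem tensorKernel_leg_right (s : S) (T : H →L[ℂ] H) (x y : ElementaryTensor S ξ) :
    tensorKernel S ξ y (x.leg s T) =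
      ⟪y.1 s, T (x.1 s)⟫_ℂ * ∏ᶠ r, if r = s then 1 else ⟪y.1 r, x.1 r⟫_ℂ := by
  have h1 : (Function.mulSupport fun r => if r = s then ⟪y.1 s, T (x.1 s)⟫_ℂ else 1).Finite :=
    (Set.finite_singleton s).subset fun r hr => by
      by_contra h
      exact hr (if_neg h)
  have h2 : (Function.mulSupport fun r => if r = s then 1 else ⟪y.1 r, x.1 r⟫_ℂ).Finite := by
    refine (x.2.union y.2).subset fun r hr => ?_
    by_contra hn
    simp only [Set.mem_union, Set.mem_ofPred_eq, not_or, not_not] at hn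
    exact hr (by simp only [hn.1, hn.2, UnitVector.inner_self, ite_self])
  have h3 : ∏ᶠ r, (if r = s then ⟪y.1 s, T (x.1 s)⟫_ℂ else 1) = ⟪y.1 s, T (x.1 s)⟫_ℂ := by
    rw [finprod_eq_single _ s fun r hr => if_neg hr, if_pos rfl]
  rw [← h3, ← finprod_mul_distrib h1 h2]
  refine finprod_congr fun r => ?_
  by_cases h : r = s
  · subst h
    simp
  · simp [h, ElementaryTensor.leg_apply_ne T x h]

theorem legOp_sub (s : S) (T T' : H →L[ℂ] H) :
    legOp ξ s (T - T') = legOp ξ s T - legOp ξ s T' := by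
  refine HilbertTensor.clm_ext fun x => HilbertTensor.ext_inner_vec fun y => ?_
  rw [sub_apply, inner_sub_right]
  simp only [ElementaryTensor.legOp_vec, ElementaryTensor.inner_vec, tensorKernel_leg_right]
  rw [sub_apply, inner_sub_right, sub_mul]

theorem norm_legOp_le (s : S) (T : H →L[ℂ] H) : ‖legOp ξ s T‖ ≤ ‖T‖ := by
  rw [legOp]
  refine ContinuousLinearMap.opNorm_le_bound _ (norm_nonneg _) fun v => ?_
  induction v using UniformSpace.Completion.induction_on with
  | hp => exact isClosed_le (by fun_prop) (by fun_prop)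
  | ih u =>
    rw [ContinuousLinearMap.completion_apply_coe, UniformSpace.Completion.norm_coe,
      UniformSpace.Completion.norm_coe]
    exact PreTensor.norm_map_leg_le s T u

theorem continuous_legOp (s : S) : Continuous (legOp ξ s) :=
  LipschitzWith.continuous (K := 1) (LipschitzWith.of_dist_le_mul fun T T' => by
    rw [dist_eq_norm, dist_eq_norm, ← legOp_sub, NNReal.coe_one, one_mul]
    exact norm_legOp_le s _)

theorem legOp_mul_legOp {s t : S} {T T' : H →L[ℂ] H} (h : s = t → T * T' = T' * T) :
    legOp ξ s T * legOp ξ t T' = legOp ξ t T' * legOp ξ s T := by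
  refine HilbertTensor.clm_ext fun x => ?_
  simp only [mul_apply_eq_comp, ElementaryTensor.legOp_vec]
  congr 1
  ext r
  by_cases hst : s = t
  · subst hst
    by_cases hr : r = s
    · subst hr
      simp only [ElementaryTensor.leg_apply_self]
      exact congrArg (fun f => f (x.1 r)) (h rfl)
    · simp only [ElementaryTensor.leg_apply_ne _ _ hr]
  · by_cases hr : r = s
    · subst hr
      simp [ElementaryTensor.leg_apply_ne _ _ hst]
    · by_cases hr' : r = t
      · subst hr'
        simp [ElementaryTensor.leg_apply_ne _ _ hr]
      · simp only [ElementaryTensor.leg_apply_ne _ _ hr, ElementaryTensor.leg_apply_ne _ _ hr']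

end LegLinear

/-! ### Cyclicity of the vacuum vector for the commutant. -/

section Commutant
variable {A : Type*} [CStarAlgebra A]
variable {H : Type*} [NormedAddCommGroup H] [InnerProductSpace ℂ H] [CompleteSpace H]
variable {G : Type*} [Group G] {π : A →⋆ₐ[ℂ] (H →L[ℂ] H)} {ξ : UnitVector H}

theorem rightOp_wreathVec (s t : G) (x : ElementaryTensor G ξ) :
    rightOp (tensorShift G ξ) s (wreathVec t x) = wreathVec (t * s⁻¹) x := by
  refine lp.ext (funext fun r => ?_)
  change (tensorShift G ξ s : HilbertTensor G ξ →L[ℂ] HilbertTensor G ξ) (wreathVec t x (r * s)) = _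
  by_cases h : r = t * s⁻¹
  · subst h
    rw [inv_mul_cancel_right, wreathVec_apply_self, wreathVec_apply_self, tensorShift_vec]
    simp
  · rw [wreathVec_apply_ne _ h, wreathVec_apply_ne _ fun h' => h (by simp [← h']), map_zero]

/-- The commutant of the generators of the von Neumann wreath product. -/
def wreathCommutant (π : A →⋆ₐ[ℂ] (H →L[ℂ] H)) (ξ : UnitVector H) (G : Type*) [Group G] :
    StarSubalgebra ℂ (WreathSpace G ξ →L[ℂ] WreathSpace G ξ) :=
  StarSubalgebra.centralizer ℂ (coeffOp (tensorShift G ξ) '' (vonNeumannTensor π ξ G) ∪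
    Set.range (translationOp (HilbertTensor G ξ)))

theorem mem_wreathCommutant_of {R : WreathSpace G ξ →L[ℂ] WreathSpace G ξ}
    (h1 : ∀ b ∈ vonNeumannTensor π ξ G,
      coeffOp (tensorShift G ξ) b * R = R * coeffOp (tensorShift G ξ) b)
    (h2 : ∀ g : G, translationOp (HilbertTensor G ξ) g * R =
      R * translationOp (HilbertTensor G ξ) g) : R ∈ wreathCommutant π ξ G := by
  rw [wreathCommutant, StarSubalgebra.mem_centralizer_iff]
  rintro _ (⟨b, hb, rfl⟩ | ⟨g, rfl⟩)
  · have h3 : star (coeffOp (tensorShift G ξ) b) = coeffOp (tensorShift G ξ) (star b) :=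
      (map_star (coeffHom (tensorShift G ξ)) b).symm
    rw [h3]
    exact ⟨h1 b hb, h1 _ (star_mem hb)⟩
  · rw [star_translationOp]
    exact ⟨h2 g, h2 _⟩

theorem rightOp_mem_wreathCommutant (s : G) :
    rightOp (tensorShift G ξ) s ∈ wreathCommutant π ξ G :=
  mem_wreathCommutant_of (fun b _ => coeffOp_mul_rightOp _ b s)
    fun g => translationOp_mul_rightOp _ g s

theorem tensorShift_conj_legOp (t s : G) (c : H →L[ℂ] H) :
    (tensorShift G ξ t : HilbertTensor G ξ →L[ℂ] HilbertTensor G ξ) * legOp ξ s c *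
      ((star (tensorShift G ξ t) : unitary (HilbertTensor G ξ →L[ℂ] HilbertTensor G ξ)) :
        HilbertTensor G ξ →L[ℂ] HilbertTensor G ξ) = legOp ξ (t * s) c := by
  refine HilbertTensor.clm_ext fun x => ?_
  rw [mul_apply_eq_comp, mul_apply_eq_comp, star_tensorShift_vec, ElementaryTensor.legOp_vec,
    tensorShift_vec, ElementaryTensor.legOp_vec]
  congr 1
  ext r
  by_cases h : r = t * s
  · subst h
    simp
  · rw [ElementaryTensor.shift_apply, ElementaryTensor.leg_apply_ne _ _ h,
      ElementaryTensor.leg_apply_ne _ _ fun h' => h (by simp [← h'])]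
    simp

/-- The shift carries the operator `c` at `s` to `c` at `t s`, which still commutes with every
tensor factor copy of `π(A)` and hence with the von Neumann algebra these generate. -/
theorem constLeg_mem_wreathCommutant (s : G) {c : H →L[ℂ] H}
    (hc : c ∈ StarSubalgebra.centralizer ℂ (Set.range π)) :
    diagOp (fun _ : G => legOp ξ s c) ‖legOp ξ s c‖ (fun _ => le_rfl) ∈ wreathCommutant π ξ G := by
  refine mem_wreathCommutant_of (fun b hb => coeffOp_mul_diagOp_const _ fun t => ?_)
    fun g => translationOp_mul_diagOp_const g _
  rw [tensorShift_conj_legOp]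
  refine (VonNeumannAlgebra.mem_generate_iff.1 hb _ ?_).symm
  rw [StarSubalgebra.mem_centralizer_iff]
  rintro _ ⟨r, a, rfl⟩
  have h := (StarSubalgebra.mem_centralizer_iff ℂ).1 hc (π a) ⟨a, rfl⟩
  rw [star_legOp]
  exact ⟨legOp_mul_legOp fun _ => h.1, legOp_mul_legOp fun _ => h.2⟩

theorem constLeg_wreathVec_one (s : G) (c : H →L[ℂ] H) (x : ElementaryTensor G ξ) :
    diagOp (fun _ : G => legOp ξ s c) ‖legOp ξ s c‖ (fun _ => le_rfl) (wreathVec 1 x) =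
      wreathVec 1 (x.leg s c) := by
  refine lp.ext (funext fun r => ?_)
  change legOp ξ s c (wreathVec 1 x r) = _
  by_cases h : r = 1
  · subst h
    rw [wreathVec_apply_self, wreathVec_apply_self, ElementaryTensor.legOp_vec]
    simp
  · rw [wreathVec_apply_ne _ h, wreathVec_apply_ne _ h, map_zero]

/-- The closure of the orbit of `Ω` under the commutant. -/
def commutantOrbit (π : A →⋆ₐ[ℂ] (H →L[ℂ] H)) (ξ : UnitVector H) (G : Type*) [Group G] :
    Submodule ℂ (WreathSpace G ξ) :=
  ((wreathCommutant π ξ G).toSubalgebra.toSubmodule.map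
    (ContinuousLinearMap.apply ℂ (WreathSpace G ξ) (vacuum G ξ)).toLinearMap).topologicalClosure

theorem apply_mem_commutantOrbit {R : WreathSpace G ξ →L[ℂ] WreathSpace G ξ}
    (hR : R ∈ wreathCommutant π ξ G) {v : WreathSpace G ξ} (hv : v ∈ commutantOrbit π ξ G) :
    R v ∈ commutantOrbit π ξ G := by
  have hle : commutantOrbit π ξ G ≤ (commutantOrbit π ξ G).comap R.toLinearMap := by
    refine Submodule.topologicalClosure_minimal _ ?_
      ((Submodule.isClosed_topologicalClosure _).preimage R.continuous)
    rintro _ ⟨T, hT, rfl⟩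
    exact Submodule.le_topologicalClosure _ ⟨R * T, (wreathCommutant π ξ G).mul_mem hR hT, rfl⟩
  exact hle hv

/-- Starting from `Ω`, constant diagonal operators from `π(A)'` and limits insert arbitrary vectors
into the tensor factors one at a time; right translations then move the group coordinate away from
`1`. -/
theorem commutantOrbit_eq_top
    (hcyc : Dense {h : H | ∃ c ∈ StarSubalgebra.centralizer ℂ (Set.range π), c ξ = h}) :
    commutantOrbit π ξ G = ⊤ := by
  classical
  have hcl : IsClosed (commutantOrbit π ξ G : Set (WreathSpace G ξ)) :=
    Submodule.isClosed_topologicalClosure _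
  have hvac : vacuum G ξ ∈ commutantOrbit π ξ G :=
    Submodule.le_topologicalClosure _ ⟨1, one_mem (wreathCommutant π ξ G), rfl⟩
  have hstep (s : G) (x : ElementaryTensor G ξ) (hx : x.1 s = ξ)
      (hm : wreathVec 1 x ∈ commutantOrbit π ξ G) (h : H) :
      wreathVec 1 (x.leg s (InnerProductSpace.rankOne ℂ h (ξ : H))) ∈ commutantOrbit π ξ G := by
    -- The rank-one operator sends `ξ` to `h`. Writing the insertion of `h` this way makes it
    -- continuous in `h`, since `legOp` is continuous in the operator.
    have hset : IsClosed {h : H | wreathVec 1 (x.leg s (InnerProductSpace.rankOne ℂ h (ξ : H))) ∈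
        commutantOrbit π ξ G} := by
      refine hcl.preimage ?_
      simp only [← coeffOp_legOp_wreathVec]
      have h1 : Continuous fun h : H => coeffHom (tensorShift G ξ)
          (legOp ξ s (InnerProductSpace.rankOne ℂ h (ξ : H))) :=
        (map_continuous (coeffHom (tensorShift G ξ))).comp ((continuous_legOp s).comp
          (((InnerProductSpace.rankOne ℂ (E := H) (F := H)).flip (ξ : H)).continuous))
      exact h1.clm_apply continuous_const
    refine closure_minimal (s := {h : H | ∃ c ∈ StarSubalgebra.centralizer ℂ (Set.range π),
      c ξ = h}) ?_ hset (hcyc h)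
    · rintro _ ⟨c, hc, rfl⟩
      have : x.leg s (InnerProductSpace.rankOne ℂ (c ξ) (ξ : H)) = x.leg s c := by
        ext r
        by_cases hr : r = s
        · subst hr
          simp [hx, ξ.2]
        · simp only [ElementaryTensor.leg_apply_ne _ _ hr]
      rw [Set.mem_ofPred_eq, this, ← constLeg_wreathVec_one]
      exact apply_mem_commutantOrbit (constLeg_mem_wreathCommutant s hc) hm
  have hone (F : Finset G) : ∀ x : ElementaryTensor G ξ, {r | x.1 r ≠ ξ} ⊆ F →
      wreathVec 1 x ∈ commutantOrbit π ξ G := by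
    induction F using Finset.induction_on with
    | empty =>
      intro x hx
      have : x = ElementaryTensor.base ξ G := by
        ext r
        by_contra h
        simpa using hx h
      rw [this]
      exact hvac
    | insert s F hs ih =>
      intro x hx
      -- The factor at `s` is reset to `ξ`, so that the induction hypothesis applies, and is
      -- restored by `hstep`.
      let y : ElementaryTensor G ξ := ⟨Function.update x.1 s ξ, x.2.subset fun r hr => by
        by_cases h : r = s
        · simp [h] at hr
        · simpa [h] using hr⟩
      have hy : wreathVec 1 y ∈ commutantOrbit π ξ G := by
        refine ih y fun r hr => ?_
        by_cases h : r = s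
        · simp [y, h] at hr
        · have : r ∈ insert s F := hx (by simpa [y, h] using hr)
          exact Finset.mem_of_mem_insert_of_ne this h
      have hys : y.1 s = ξ := by simp [y]
      have := hstep s y hys hy (x.1 s)
      convert this using 2
      ext r
      by_cases hr : r = s
      · subst hr
        simp [hys, ξ.2]
      · rw [ElementaryTensor.leg_apply_ne _ _ hr]
        simp [y, hr]
  rw [eq_top_iff, ← span_wreathVec]
  refine Submodule.topologicalClosure_minimal _ (Submodule.span_le.2 ?_) hcl
  rintro _ ⟨t, x, rfl⟩
  have h1 : rightOp (tensorShift G ξ) t⁻¹ (wreathVec 1 x) = wreathVec t x := by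
    rw [rightOp_wreathVec, one_mul, inv_inv]
  rw [← h1]
  exact apply_mem_commutantOrbit (rightOp_mem_wreathCommutant _)
    (hone x.2.toFinset x (by simp))

/-! ## Central sequences in von Neumann wreath products -/

theorem inner_vacuum_self : ⟪vacuum G ξ, vacuum G ξ⟫_ℂ = 1 := by
  rw [vacuum, inner_wreathVec_self, tensorKernel]
  exact finprod_eq_one_of_forall_eq_one fun r => UnitVector.inner_self ξ

/-- The operator `λ_g ρ_g` conjugates the group coordinate by `g` and shifts the tensor. Freeness
leaves only the coordinate `1`, and the shifted tensor meets `Λ` only in copies of `ξ`. -/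
theorem inner_translationOp_rightOp {Λ : Subgroup G} {g : G} (hg : g ∉ Λ)
    (hfree : ∀ h ∈ Λ, g⁻¹ * h * g ∈ Λ → h = 1) {v w : WreathSpace G ξ}
    (hv : v ∈ wreathSpan ξ (Λ : Set G)) (hw : w ∈ wreathSpan ξ (Λ : Set G)) :
    ⟪v, translationOp (HilbertTensor G ξ) g (rightOp (tensorShift G ξ) g w)⟫_ℂ =
      ⟪v, vacuum G ξ⟫_ℂ * ⟪vacuum G ξ, w⟫_ℂ := by
  have hinv {r : G} (hr : r ∈ Λ) : g⁻¹ * r ∉ Λ := fun h =>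
    hg (inv_mem_iff.1 ((Λ.mul_mem_cancel_right hr).1 h))
  have h := inner_eqOn_wreathSpan
    (B := translationOp (HilbertTensor G ξ) g * rightOp (tensorShift G ξ) g)
    (B' := InnerProductSpace.rankOne ℂ (vacuum G ξ) (vacuum G ξ))
    (fun s hs y hy t ht x hx => ?_) hv hw
  · refine Eq.trans h ?_
    rw [InnerProductSpace.rankOne_apply, inner_smul_right, mul_comm]
  · rw [InnerProductSpace.rankOne_apply, inner_smul_right, mul_apply_eq_comp, rightOp_wreathVec,
      translationOp_wreathVec]
    -- Here `g⁻¹ s g = t ∈ Λ`, so `s = t = 1`. For `r ∈ Λ` the factor `x (g⁻¹ r)` is `ξ`, and off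
    -- `Λ` the factor of `y` is `ξ`, so the inner product splits.
    by_cases hst : s = g * (t * g⁻¹)
    · have hs1 : s = 1 := hfree s hs (by rw [hst]; simpa [mul_assoc] using ht)
      subst hs1
      have ht1 : t = 1 := by
        rw [← mul_assoc] at hst
        simpa [mul_assoc] using (conj_eq_one_iff (a := g) (b := t)).1 hst.symm
      subst ht1
      rw [← hst, vacuum, inner_wreathVec_self, inner_wreathVec_self, inner_wreathVec_self,
        ← tensorKernel_shift g (ElementaryTensor.base ξ G) x]
      refine tensorKernel_mul_of_eq fun r => ?_
      simp only [ElementaryTensor.shift_base, ElementaryTensor.base_apply,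
        ElementaryTensor.shift_apply]
      by_cases hr : r ∈ Λ
      · rw [hx _ (hinv hr), UnitVector.inner_self, one_mul]
      · rw [hy r hr, UnitVector.inner_self, mul_one]
    · rw [inner_wreathVec_ne hst]
      by_cases hs1 : s = 1
      · have ht1 : 1 ≠ t := fun h => hst (by simp [← h, hs1])
        rw [vacuum, inner_wreathVec_ne ht1, zero_mul]
      · rw [vacuum, inner_wreathVec_ne hs1, mul_zero]

theorem tendsto_zero_of_mem_closure {E : Type*} [NormedAddCommGroup E] [NormedSpace ℂ E]
    {Z : ℕ → E →L[ℂ] E} {C : ℝ} (hC : ∀ n, ‖Z n‖ ≤ C) {s : Set E}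
    (hs : ∀ v ∈ s, Tendsto (fun n => Z n v) atTop (𝓝 0)) {v : E} (hv : v ∈ closure s) :
    Tendsto (fun n => Z n v) atTop (𝓝 0) := by
  have hC0 : 0 ≤ C := (norm_nonneg _).trans (hC 0)
  rw [Metric.tendsto_atTop]
  intro ε hε
  -- The constant `C + 1` keeps the denominator positive when `C = 0`.
  obtain ⟨u, hu, huv⟩ := Metric.mem_closure_iff.1 hv (ε / (2 * (C + 1))) (by positivity)
  obtain ⟨N, hN⟩ := Metric.tendsto_atTop.1 (hs u hu) (ε / 2) (by positivity)
  refine ⟨N, fun n hn => ?_⟩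
  have h1 := hN n hn
  rw [dist_zero_right] at h1 ⊢
  rw [dist_eq_norm] at huv
  have h2 : ‖Z n (v - u)‖ ≤ (C + 1) * (ε / (2 * (C + 1))) := by
    refine ((Z n).le_of_opNorm_le (hC n) _).trans ?_
    gcongr
    linarith
  have h3 : (C + 1) * (ε / (2 * (C + 1))) = ε / 2 := by field_simp
  have h4 : Z n v = Z n u + Z n (v - u) := by simp
  rw [h4]
  exact (norm_add_le _ _).trans_lt (by linarith)

/-- Convergence is first proved at `Ω`, where commutation with a single `λ_g` is enough, and is then
carried to the dense orbit of `Ω` under the commutant; uniform boundedness gives all vectors. -/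
theorem HasFreeConjugators.tendsto_sub_inner_vacuum (hG : HasFreeConjugators G)
    (hcyc : Dense {h : H | ∃ c ∈ StarSubalgebra.centralizer ℂ (Set.range π), c ξ = h})
    {x : ℕ → WreathSpace G ξ →L[ℂ] WreathSpace G ξ}
    (hx : ∀ n, x n ∈ vonNeumannCrossedProduct (tensorShift G ξ) (vonNeumannTensor π ξ G))
    {C : ℝ} (hC : ∀ n, ‖x n‖ ≤ C)
    (hcomm : ∀ (g : G) (v : WreathSpace G ξ), Tendsto (fun n =>
      (x n * translationOp (HilbertTensor G ξ) g - translationOp (HilbertTensor G ξ) g * x n) v)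
      atTop (𝓝 0)) (v : WreathSpace G ξ) :
    Tendsto (fun n => (x n - algebraMap ℂ (WreathSpace G ξ →L[ℂ] WreathSpace G ξ)
      ⟪vacuum G ξ, x n (vacuum G ξ)⟫_ℂ) v) atTop (𝓝 0) := by
  set c : ℕ → ℂ := fun n => ⟪vacuum G ξ, x n (vacuum G ξ)⟫_ℂ with hc
  set Z : ℕ → WreathSpace G ξ →L[ℂ] WreathSpace G ξ :=
    fun n => x n - algebraMap ℂ (WreathSpace G ξ →L[ℂ] WreathSpace G ξ) (c n) with hZ
  have hcom (n : ℕ) {R : WreathSpace G ξ →L[ℂ] WreathSpace G ξ}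
      (hR : R ∈ wreathCommutant π ξ G) : R * x n = x n * R :=
    VonNeumannAlgebra.mem_generate_iff.1 (hx n) R hR
  have hnorm : ‖vacuum G ξ‖ = 1 := by
    have := inner_self_eq_norm_sq (𝕜 := ℂ) (vacuum G ξ)
    rw [inner_vacuum_self, RCLike.one_re] at this
    exact (pow_eq_one_iff_of_nonneg (norm_nonneg _) two_ne_zero).1 this.symm
  choose D hD hxD using fun n => exists_countable_mem_wreathSpan (x n (vacuum G ξ))
  obtain ⟨Λ, hΛ, g, hg, hfree⟩ := hG (⋃ n, D n) (Set.countable_iUnion hD)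
  have hvac : Tendsto (fun n => Z n (vacuum G ξ)) atTop (𝓝 0) := by
    refine squeeze_zero_norm (fun n => ?_)
      (tendsto_zero_iff_norm_tendsto_zero.1 (hcomm g (wreathVec g⁻¹ (ElementaryTensor.base ξ G))))
    set u := translationOp (HilbertTensor G ξ) g with hu
    set w := Z n (vacuum G ξ) with hw
    have hw' : w = x n (vacuum G ξ) - c n • vacuum G ξ := rfl
    have hmx : x n (vacuum G ξ) ∈ wreathSpan ξ (Λ : Set G) :=
      wreathSpan_mono ((Set.subset_iUnion D n).trans hΛ) (hxD n)
    have hmΩ : vacuum G ξ ∈ wreathSpan ξ (Λ : Set G) :=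
      wreathVec_mem_wreathSpan Λ.one_mem fun r _ => rfl
    have hmw : w ∈ wreathSpan ξ (Λ : Set G) :=
      hw' ▸ Submodule.sub_mem _ hmx (Submodule.smul_mem _ _ hmΩ)
    have h0 : ⟪w, vacuum G ξ⟫_ℂ = 0 := by
      rw [← inner_conj_symm, hw', inner_sub_right, inner_smul_right, inner_vacuum_self, mul_one,
        sub_self, map_zero]
    have h1 : wreathVec g⁻¹ (ElementaryTensor.base ξ G) =
        rightOp (tensorShift G ξ) g (vacuum G ξ) := by
      rw [vacuum, rightOp_wreathVec, one_mul]
    -- The test vector is `ρ_g Ω`, which `λ_g` sends back to `Ω`; moreover `x_n` commutes with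
    -- `ρ_g`.
    have h2 : (x n * u - u * x n) (wreathVec g⁻¹ (ElementaryTensor.base ξ G)) =
        x n (vacuum G ξ) - u (rightOp (tensorShift G ξ) g (x n (vacuum G ξ))) := by
      rw [sub_apply, mul_apply_eq_comp, mul_apply_eq_comp, hu, translationOp_wreathVec]
      congr 2
      · simp [vacuum]
      · rw [h1]
        exact congrArg (fun f => f (vacuum G ξ)) (hcom n (rightOp_mem_wreathCommutant g)).symm
    -- On `Λ` the operator `λ_g ρ_g` acts as the projection onto `Ω`, and `w ⟂ Ω`, so the second
    -- term contributes nothing.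
    have h3 : ⟪w, x n (vacuum G ξ) - u (rightOp (tensorShift G ξ) g (x n (vacuum G ξ)))⟫_ℂ =
        ⟪w, w⟫_ℂ := by
      rw [inner_sub_right, inner_translationOp_rightOp hg hfree hmw hmx, h0, zero_mul, sub_zero]
      nth_rewrite 3 [hw']
      rw [inner_sub_right, inner_smul_right, h0, mul_zero, sub_zero]
    rw [h2]
    have h4 : ‖w‖ ^ 2 ≤ ‖w‖ *
        ‖x n (vacuum G ξ) - u (rightOp (tensorShift G ξ) g (x n (vacuum G ξ)))‖ := by
      rw [← @inner_self_eq_norm_sq ℂ, ← h3]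
      exact (RCLike.re_le_norm _).trans (norm_inner_le_norm _ _)
    rcases (norm_nonneg w).eq_or_lt with h | h
    · rw [← h]; positivity
    · rw [sq] at h4
      exact le_of_mul_le_mul_left h4 h
  have hZC (n : ℕ) : ‖Z n‖ ≤ C + C := by
    refine (norm_sub_le _ _).trans (add_le_add (hC n) ?_)
    have h1 : ‖algebraMap ℂ (WreathSpace G ξ →L[ℂ] WreathSpace G ξ) (c n)‖ ≤ ‖c n‖ :=
      ContinuousLinearMap.opNorm_le_bound _ (norm_nonneg _) fun v => (norm_smul (c n) v).le
    refine h1.trans ?_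
    refine (norm_inner_le_norm _ _).trans ?_
    rw [hnorm, one_mul]
    refine ((x n).le_opNorm _).trans ?_
    rw [hnorm, mul_one]
    exact hC n
  have hv : v ∈ commutantOrbit π ξ G := by
    rw [commutantOrbit_eq_top hcyc]
    exact Submodule.mem_top
  refine tendsto_zero_of_mem_closure hZC ?_ hv
  rintro _ ⟨R, hR, rfl⟩
  have h5 (n : ℕ) : Z n (R (vacuum G ξ)) = R (Z n (vacuum G ξ)) := by
    have : R * Z n = Z n * R := by
      rw [hZ, mul_sub, sub_mul, hcom n hR, Algebra.commutes]
    exact (congrArg (fun f => f (vacuum G ξ)) this).symm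
  have h6 := (R.continuous.tendsto 0).comp hvac
  rw [map_zero] at h6
  exact h6.congr fun n => (h5 n).symm

theorem HasFreeConjugators.noNontrivialCentralSequences_crossedProduct (hG : HasFreeConjugators G)
    (hcyc : Dense {h : H | ∃ c ∈ StarSubalgebra.centralizer ℂ (Set.range π), c ξ = h}) :
    (vonNeumannCrossedProduct (tensorShift G ξ)
      (vonNeumannTensor π ξ G)).NoNontrivialCentralSequences := by
  rintro x hx ⟨C, hC⟩ hcomm
  have hmem (g : G) : translationOp (HilbertTensor G ξ) g ∈
      vonNeumannCrossedProduct (tensorShift G ξ) (vonNeumannTensor π ξ G) :=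
    VonNeumannAlgebra.subset_generate (Or.inr ⟨g, rfl⟩)
  have h1 := hG.tendsto_sub_inner_vacuum hcyc hx hC fun g v => (hcomm _ (hmem g) v).1
  have h2 := hG.tendsto_sub_inner_vacuum hcyc (x := fun n => star (x n))
    (fun n => star_mem (hx n)) (fun n => (norm_star (x n)).trans_le (hC n)) fun g v => by
      -- The adjoint of `[x_n, λ_{g⁻¹}]` is `-[x_n⋆, λ_g]`.
      have := ((hcomm _ (hmem g⁻¹) v).2).neg
      rw [neg_zero] at this
      refine this.congr fun n => ?_
      rw [star_sub, star_mul, star_mul, star_translationOp, inv_inv, ← neg_apply, neg_sub]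
  refine ⟨fun n => ⟪vacuum G ξ, x n (vacuum G ξ)⟫_ℂ, fun v => ⟨h1 v, (h2 v).congr fun n => ?_⟩⟩
  have h3 : ⟪vacuum G ξ, star (x n) (vacuum G ξ)⟫_ℂ = star ⟪vacuum G ξ, x n (vacuum G ξ)⟫_ℂ := by
    rw [ContinuousLinearMap.star_eq_adjoint, ContinuousLinearMap.adjoint_inner_right]
    exact (inner_conj_symm _ _).symm
  rw [star_sub, h3, algebraMap_star_comm]

end Commutant
/-! ## The commutant of a GNS representation -/

section Amplification
variable {H : Type*} [NormedAddCommGroup H] [InnerProductSpace ℂ H] [CompleteSpace H]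

/-- The amplification `x ↦ x ⊗ 1` on a countable direct sum of copies of `H`. -/
def amplify (H : Type*) [NormedAddCommGroup H] [InnerProductSpace ℂ H] [CompleteSpace H] :
    (H →L[ℂ] H) →⋆ₐ[ℂ] (lp (fun _ : Multiplicative ℤ => H) 2 →L[ℂ]
      lp (fun _ : Multiplicative ℤ => H) 2) :=
  -- The group `ℤ` acts trivially and serves only as a countable index set.
  coeffHom 1

@[simp] theorem amplify_apply (x : H →L[ℂ] H) (ζ : lp (fun _ : Multiplicative ℤ => H) 2)
    (i : Multiplicative ℤ) : amplify H x ζ i = x (ζ i) := by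
  change (((star (1 : unitary (H →L[ℂ] H)) : unitary (H →L[ℂ] H)) : H →L[ℂ] H) * x *
    ((1 : unitary (H →L[ℂ] H)) : H →L[ℂ] H)) (ζ i) = _
  rw [star_one, OneMemClass.coe_one, one_mul, mul_one]

/-- The matrix unit that maps the summand `j` to the summand `i`. -/
def matrixUnit (H : Type*) [NormedAddCommGroup H] [InnerProductSpace ℂ H] [CompleteSpace H]
    (i j : Multiplicative ℤ) :
    lp (fun _ : Multiplicative ℤ => H) 2 →L[ℂ] lp (fun _ : Multiplicative ℤ => H) 2 :=
  (lp.singleContinuousLinearMap ℂ (fun _ : Multiplicative ℤ => H) 2 i).comp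
    (lp.evalCLM ℂ (fun _ : Multiplicative ℤ => H) 2 j)

theorem matrixUnit_apply (i j : Multiplicative ℤ) (ζ : lp (fun _ : Multiplicative ℤ => H) 2) :
    matrixUnit H i j ζ = lp.single 2 i (ζ j) := rfl

theorem amplify_single (x : H →L[ℂ] H) (i : Multiplicative ℤ) (h : H) :
    amplify H x (lp.single 2 i h) = lp.single 2 i (x h) := by
  refine lp.ext (funext fun j => ?_)
  rw [amplify_apply]
  by_cases hj : j = i
  · subst hj
    rw [lp.single_apply_self, lp.single_apply_self]
  · rw [lp.single_apply_ne _ _ _ hj, lp.single_apply_ne _ _ _ hj, map_zero]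

/-- The commutant of an amplified von Neumann algebra. -/
def amplifiedCommutant (M : VonNeumannAlgebra H) :
    StarSubalgebra ℂ (lp (fun _ : Multiplicative ℤ => H) 2 →L[ℂ]
      lp (fun _ : Multiplicative ℤ => H) 2) :=
  StarSubalgebra.centralizer ℂ (amplify H '' M)

theorem mem_amplifiedCommutant {M : VonNeumannAlgebra H}
    {R : lp (fun _ : Multiplicative ℤ => H) 2 →L[ℂ] lp (fun _ : Multiplicative ℤ => H) 2} :
    R ∈ amplifiedCommutant M ↔ ∀ x ∈ M, amplify H x * R = R * amplify H x := by
  rw [amplifiedCommutant, StarSubalgebra.mem_centralizer_iff]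
  refine ⟨fun h x hx => (h _ ⟨x, hx, rfl⟩).1, ?_⟩
  rintro h _ ⟨x, hx, rfl⟩
  rw [← map_star]
  exact ⟨h x hx, h _ (star_mem hx)⟩

theorem matrixUnit_mem_amplifiedCommutant (M : VonNeumannAlgebra H) (i j : Multiplicative ℤ) :
    matrixUnit H i j ∈ amplifiedCommutant M := by
  rw [mem_amplifiedCommutant]
  intro x _
  ext1 ζ
  rw [mul_apply_eq_comp, mul_apply_eq_comp, matrixUnit_apply, matrixUnit_apply, amplify_single,
    amplify_apply]

theorem amplify_mem_amplifiedCommutant {M : VonNeumannAlgebra H} {c : H →L[ℂ] H}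
    (hc : c ∈ M.commutant) : amplify H c ∈ amplifiedCommutant M := by
  rw [mem_amplifiedCommutant]
  intro x hx
  rw [← map_mul, ← map_mul, VonNeumannAlgebra.mem_commutant_iff.1 hc x hx]

/-- The double commutant of an amplified von Neumann algebra is the amplification. -/
theorem exists_amplify_eq (M : VonNeumannAlgebra H)
    {T : lp (fun _ : Multiplicative ℤ => H) 2 →L[ℂ] lp (fun _ : Multiplicative ℤ => H) 2}
    (hT : ∀ R ∈ amplifiedCommutant M, R * T = T * R) : ∃ x ∈ M, amplify H x = T := by
  -- The compression of `T` to the summand `1`; commutation with the matrix units forces every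
  -- diagonal block to equal it and the others to vanish.
  let x : H →L[ℂ] H := ((lp.evalCLM ℂ (fun _ : Multiplicative ℤ => H) 2 1).comp T).comp
    (lp.singleContinuousLinearMap ℂ (fun _ : Multiplicative ℤ => H) 2 1)
  have hx (h : H) : x h = T (lp.single 2 1 h) 1 := rfl
  refine ⟨x, ?_, ?_⟩
  · rw [← M.commutant_commutant, VonNeumannAlgebra.mem_commutant_iff]
    intro c hc
    ext1 h
    rw [mul_apply_eq_comp, mul_apply_eq_comp, hx, hx, ← amplify_single, ← amplify_apply,
      ← mul_apply_eq_comp, ← mul_apply_eq_comp, hT _ (amplify_mem_amplifiedCommutant hc)]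
  · ext1 ζ
    refine lp.ext (funext fun j => ?_)
    have h := congrArg (fun f => f ζ) (hT _ (matrixUnit_mem_amplifiedCommutant M 1 j))
    simp only [mul_apply_eq_comp, matrixUnit_apply] at h
    rw [amplify_apply, hx, ← h, lp.single_apply_self]

/-- A separating vector of an amplified von Neumann algebra is cyclic for the commutant. -/
theorem dense_amplifiedCommutant_apply (M : VonNeumannAlgebra H)
    {κ : lp (fun _ : Multiplicative ℤ => H) 2} (hκ : ∀ x ∈ M, amplify H x κ = 0 → x = 0) :
    Dense {v | ∃ R ∈ amplifiedCommutant M, R κ = v} := by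
  let V₀ : Submodule ℂ (lp (fun _ : Multiplicative ℤ => H) 2) :=
    (amplifiedCommutant M).toSubalgebra.toSubmodule.map (ContinuousLinearMap.apply ℂ _ κ).toLinearMap
  let V := V₀.topologicalClosure
  have hinv {R : lp (fun _ : Multiplicative ℤ => H) 2 →L[ℂ] lp (fun _ : Multiplicative ℤ => H) 2}
      (hR : R ∈ amplifiedCommutant M) : V ≤ V.comap R.toLinearMap := by
    refine Submodule.topologicalClosure_minimal _ ?_
      ((Submodule.isClosed_topologicalClosure _).preimage R.continuous)
    rintro _ ⟨T, hT, rfl⟩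
    exact Submodule.le_topologicalClosure _ ⟨R * T, (amplifiedCommutant M).mul_mem hR hT, rfl⟩
  have : CompleteSpace V := (Submodule.isClosed_topologicalClosure V₀).completeSpace_coe
  -- The closed orbit `V` of `κ` is invariant under the commutant, so its projection lies in the
  -- double commutant and is an amplification.
  have hp : V.starProjection ∈ VonNeumannAlgebra.generate (amplify H '' M) := by
    rw [VonNeumannAlgebra.IsStarProjection.mem_iff isStarProjection_starProjection]
    intro R hR
    rw [Submodule.range_starProjection]
    refine hinv (mem_amplifiedCommutant.2 fun x hx => ?_)
    exact VonNeumannAlgebra.mem_commutant_iff.1 hR _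
      (VonNeumannAlgebra.subset_generate ⟨x, hx, rfl⟩)
  obtain ⟨x, hxM, hx⟩ := exists_amplify_eq M (VonNeumannAlgebra.mem_generate_iff.1 hp)
  have hκV : κ ∈ V := Submodule.le_topologicalClosure _ ⟨1, one_mem (amplifiedCommutant M), rfl⟩
  -- The projection fixes `κ`, so the separating property makes it the identity.
  have h1 : 1 - x = 0 := by
    refine hκ _ (sub_mem (one_mem M) hxM) ?_
    rw [map_sub, map_one, hx, sub_apply, one_apply_eq_self,
      Submodule.starProjection_eq_self_iff.2 hκV, sub_self]
  have htop : V = ⊤ := by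
    rw [← Submodule.range_starProjection V, ← hx, ← sub_eq_zero.1 h1, map_one]
    exact LinearMap.range_id
  intro v
  have hv : v ∈ V := htop ▸ Submodule.mem_top
  exact hv

end Amplification

/-! ### GNS spaces of dominated functionals and intertwiners. -/

section Intertwiner
variable {A : Type*} [CStarAlgebra A] [PartialOrder A] [StarOrderedRing A]
variable {E : Type*} [NormedAddCommGroup E] [InnerProductSpace ℂ E] [CompleteSpace E]

theorem inner_map_star_mul_self (ρ : A →⋆ₐ[ℂ] (E →L[ℂ] E)) (ζ : E) (s : A) :
    ⟪ζ, ρ (star s * s) ζ⟫_ℂ = ⟪ρ s ζ, ρ s ζ⟫_ℂ := by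
  rw [map_mul, map_star, mul_apply_eq_comp, ContinuousLinearMap.star_eq_adjoint,
    ContinuousLinearMap.adjoint_inner_right]

/-- The vector functional `x ↦ ⟪ζ, ρ(x) ζ⟫`. -/
def vectorFunctional (ρ : A →⋆ₐ[ℂ] (E →L[ℂ] E)) (ζ : E) : A →ₚ[ℂ] ℂ :=
  PositiveLinearMap.mk₀
    { toFun := fun x => ⟪ζ, ρ x ζ⟫_ℂ
      map_add' := fun x y => by rw [map_add, add_apply, inner_add_right]
      map_smul' := fun c x => by
        rw [map_smul, smul_apply, inner_smul_right, RingHom.id_apply, smul_eq_mul] }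
    fun x hx => by
      obtain ⟨s, rfl⟩ := CStarAlgebra.nonneg_iff_eq_star_mul_self.1 hx
      change 0 ≤ ⟪ζ, ρ (star s * s) ζ⟫_ℂ
      rw [inner_map_star_mul_self, inner_self_eq_norm_sq_to_K]
      positivity

theorem norm_preGNS_vectorFunctional (ρ : A →⋆ₐ[ℂ] (E →L[ℂ] E)) (ζ : E)
    (x : (vectorFunctional ρ ζ).PreGNS) :
    ‖x‖ = ‖ρ ((vectorFunctional ρ ζ).ofPreGNS x) ζ‖ := by
  set y := (vectorFunctional ρ ζ).ofPreGNS x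
  rw [PositiveLinearMap.preGNS_norm_def]
  change √(⟪ζ, ρ (star y * y) ζ⟫_ℂ).re = _
  rw [inner_map_star_mul_self, ← RCLike.re_eq_complex_re, inner_self_eq_norm_sq,
    Real.sqrt_sq (norm_nonneg _)]

theorem gnsStarAlgHom_coe (θ : A →ₚ[ℂ] ℂ) (x : A) (y : θ.PreGNS) :
    θ.gnsStarAlgHom x (y : θ.GNS) = (θ.toPreGNS (x * θ.ofPreGNS y) : θ.PreGNS) :=
  θ.gnsNonUnitalStarAlgHom_apply_coe

theorem inner_gnsStarAlgHom (θ : A →ₚ[ℂ] ℂ) (x : A) (a b : θ.GNS) :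
    ⟪θ.gnsStarAlgHom x a, b⟫_ℂ = ⟪a, θ.gnsStarAlgHom (star x) b⟫_ℂ := by
  rw [map_star, ContinuousLinearMap.star_eq_adjoint, ContinuousLinearMap.adjoint_inner_right]

/-- The GNS space of a vector functional embeds isometrically. -/
theorem exists_isometry_vectorFunctional (ρ : A →⋆ₐ[ℂ] (E →L[ℂ] E)) (ζ : E) :
    ∃ W : (vectorFunctional ρ ζ).GNS →L[ℂ] E, (∀ v, ‖W v‖ = ‖v‖) ∧
      ∀ x v, W ((vectorFunctional ρ ζ).gnsStarAlgHom x v) = ρ x (W v) := by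
  set ψ := vectorFunctional ρ ζ with hψ
  let W₀ : ψ.PreGNS →L[ℂ] E :=
    LinearMap.mkContinuous
      { toFun := fun x => ρ (ψ.ofPreGNS x) ζ
        map_add' := fun x y => by rw [map_add, map_add, add_apply]
        map_smul' := fun c x => by rw [map_smul, map_smul, smul_apply, RingHom.id_apply] } 1
      fun x => by
        rw [one_mul, norm_preGNS_vectorFunctional]
        exact le_rfl
  have hW (x : ψ.PreGNS) : W₀.fromCompletion (x : ψ.GNS) = ρ (ψ.ofPreGNS x) ζ :=
    ContinuousLinearMap.fromCompletion_apply_coe W₀ x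
  refine ⟨W₀.fromCompletion, fun v => ?_, fun x v => ?_⟩
  · induction v using UniformSpace.Completion.induction_on with
    | hp => exact isClosed_eq (by fun_prop) (by fun_prop)
    | ih x => rw [hW, UniformSpace.Completion.norm_coe, norm_preGNS_vectorFunctional]
  · induction v using UniformSpace.Completion.induction_on with
    | hp => exact isClosed_eq (by fun_prop) (by fun_prop)
    | ih y =>
      rw [gnsStarAlgHom_coe, hW, hW, PositiveLinearMap.ofPreGNS_toPreGNS, map_mul,
        mul_apply_eq_comp]

/-- If `φ ≤ ψ`, then the GNS space of `ψ` maps onto a dense subspace of the GNS space of `φ`. -/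
theorem exists_gns_map {φ ψ : A →ₚ[ℂ] ℂ} (h : ∀ x, ‖φ.toPreGNS x‖ ≤ ‖ψ.toPreGNS x‖) :
    ∃ J : ψ.GNS →L[ℂ] φ.GNS, (∀ y : φ.PreGNS, (y : φ.GNS) ∈ Set.range J) ∧
      ∀ x v, J (ψ.gnsStarAlgHom x v) = φ.gnsStarAlgHom x (J v) := by
  let J₀ : ψ.PreGNS →L[ℂ] φ.PreGNS :=
    (φ.toPreGNS.toLinearMap ∘ₗ ψ.ofPreGNS.toLinearMap).mkContinuous 1 fun x => by
      rw [one_mul]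
      exact h (ψ.ofPreGNS x)
  have hJ (x : ψ.PreGNS) :
      J₀.completion (x : ψ.GNS) = (φ.toPreGNS (ψ.ofPreGNS x) : φ.PreGNS) :=
    ContinuousLinearMap.completion_apply_coe J₀ x
  refine ⟨J₀.completion, fun y => ⟨(ψ.toPreGNS (φ.ofPreGNS y) : ψ.PreGNS), hJ _⟩, fun x v => ?_⟩
  induction v using UniformSpace.Completion.induction_on with
  | hp => exact isClosed_eq (by fun_prop) (by fun_prop)
  | ih y =>
    rw [gnsStarAlgHom_coe, hJ, hJ, gnsStarAlgHom_coe]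
    rfl

/-- The GNS representation of a functional that is dominated by a vector functional of `ρ` maps to
`ρ` by an injective intertwiner. -/
theorem exists_injective_intertwiner {φ : A →ₚ[ℂ] ℂ} (ρ : A →⋆ₐ[ℂ] (E →L[ℂ] E)) {ζ : E}
    (hζ : ∀ x, ‖φ.toPreGNS x‖ ≤ ‖ρ x ζ‖) :
    ∃ K : φ.GNS →L[ℂ] E, Function.Injective K ∧
      ∀ x v, K (φ.gnsStarAlgHom x v) = ρ x (K v) := by
  obtain ⟨W, hWnorm, hWx⟩ := exists_isometry_vectorFunctional ρ ζ
  obtain ⟨J, hJ, hJx⟩ := exists_gns_map (φ := φ) (ψ := vectorFunctional ρ ζ) fun x => by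
    rw [norm_preGNS_vectorFunctional]
    exact hζ x
  -- The map `J` points from the larger functional to `φ`; its adjoint goes the other way and is
  -- injective because `J` has dense range.
  refine ⟨W.comp (ContinuousLinearMap.adjoint J), ?_, fun x v => ?_⟩
  · refine (injective_iff_map_eq_zero _).2 fun v hv => ?_
    have h1 : ContinuousLinearMap.adjoint J v = 0 := by
      rw [← norm_eq_zero, ← hWnorm]
      exact norm_eq_zero.2 hv
    have h2 (w : φ.GNS) : ⟪v, w⟫_ℂ = 0 := by
      induction w using UniformSpace.Completion.induction_on with
      | hp => exact isClosed_eq (by fun_prop) (by fun_prop)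
      | ih y =>
        obtain ⟨z, hz⟩ := hJ y
        rw [← hz, ← ContinuousLinearMap.adjoint_inner_left, h1, inner_zero_left]
    exact inner_self_eq_zero.1 (h2 v)
  · rw [ContinuousLinearMap.comp_apply, ContinuousLinearMap.comp_apply, ← hWx]
    congr 1
    refine ext_inner_right ℂ fun w => ?_
    rw [ContinuousLinearMap.adjoint_inner_left, inner_gnsStarAlgHom, inner_gnsStarAlgHom, ← hJx,
      ContinuousLinearMap.adjoint_inner_left]

/-- The canonical vector of `φ` is cyclic for the commutant of the GNS representation as soon as an
injective intertwiner maps it to a cyclic vector for the commutant of `ρ`. -/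
theorem dense_gns_commutant_apply {φ : A →ₚ[ℂ] ℂ} {ρ : A →⋆ₐ[ℂ] (E →L[ℂ] E)} {K : φ.GNS →L[ℂ] E}
    (hKinj : Function.Injective K) (hK : ∀ x v, K (φ.gnsStarAlgHom x v) = ρ x (K v)) {v₀ : φ.GNS}
    (hdense : Dense {v | ∃ R ∈ StarSubalgebra.centralizer ℂ (Set.range ρ), R (K v₀) = v}) :
    Dense {h : φ.GNS | ∃ c ∈ StarSubalgebra.centralizer ℂ (Set.range φ.gnsStarAlgHom),
      c v₀ = h} := by
  have hKadj (x : A) (v : E) : ContinuousLinearMap.adjoint K (ρ x v) =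
        φ.gnsStarAlgHom x (ContinuousLinearMap.adjoint K v) := by
    refine ext_inner_right ℂ fun w => ?_
    rw [ContinuousLinearMap.adjoint_inner_left, inner_gnsStarAlgHom,
      ContinuousLinearMap.adjoint_inner_left, hK, map_star, ContinuousLinearMap.star_eq_adjoint,
      ContinuousLinearMap.adjoint_inner_right]
  -- The orthogonal complement of the range of `K⋆` is the kernel of `K`, which is trivial.
  have hrange : DenseRange (ContinuousLinearMap.adjoint K) := by
    rw [DenseRange, ← ContinuousLinearMap.coe_coe, ← LinearMap.coe_range,
      Submodule.dense_iff_topologicalClosure_eq_top, Submodule.topologicalClosure_eq_top_iff,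
      Submodule.eq_bot_iff]
    intro v hv
    refine hKinj (ext_inner_left ℂ fun w => ?_)
    rw [map_zero, inner_zero_right, ← ContinuousLinearMap.adjoint_inner_left]
    exact hv _ ⟨w, rfl⟩
  refine (hrange.dense_image (ContinuousLinearMap.adjoint K).continuous hdense).mono ?_
  rintro _ ⟨_, ⟨R, hR, rfl⟩, rfl⟩
  -- For `R` in the commutant of `ρ`, the compression `K⋆ R K` commutes with the GNS representation,
  -- since `K` and `K⋆` both intertwine.
  refine ⟨((ContinuousLinearMap.adjoint K).comp R).comp K, ?_, rfl⟩
  have hcomm (x : A) : φ.gnsStarAlgHom x * ((ContinuousLinearMap.adjoint K).comp R).comp K =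
        ((ContinuousLinearMap.adjoint K).comp R).comp K * φ.gnsStarAlgHom x := by
    ext1 v
    have h1 := congrArg (fun f => f (K v))
      ((StarSubalgebra.mem_centralizer_iff ℂ).1 hR (ρ x) ⟨x, rfl⟩).1
    simp only [mul_apply_eq_comp] at h1
    change φ.gnsStarAlgHom x (ContinuousLinearMap.adjoint K (R (K v))) =
      ContinuousLinearMap.adjoint K (R (K (φ.gnsStarAlgHom x v)))
    rw [← hKadj, h1, hK]
  rw [StarSubalgebra.mem_centralizer_iff]
  rintro _ ⟨x, rfl⟩
  rw [← map_star]
  exact ⟨hcomm x, hcomm _⟩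

end Intertwiner

/-! ### Faithful normal states and their canonical vectors. -/

section GNS
variable {H : Type*} [NormedAddCommGroup H] [InnerProductSpace ℂ H] [CompleteSpace H]
variable {M : VonNeumannAlgebra H}

/-- An enumeration of `ℕ ⊕ ℕ`. -/
def sumEquiv : Multiplicative ℤ ≃ ℕ ⊕ ℕ := Multiplicative.toAdd.trans Equiv.intEquivNatSumNat

theorem exists_lp_sumElim {ξ η : ℕ → H} (hξ : Summable fun n => ‖ξ n‖ ^ 2)
    (hη : Summable fun n => ‖η n‖ ^ 2) : ∃ ζ : lp (fun _ : Multiplicative ℤ => H) 2,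
      ∀ i, ζ i = Sum.elim ξ η (sumEquiv i) :=
  ⟨⟨fun i => Sum.elim ξ η (sumEquiv i), memℓp_two_of_summable
    ((sumEquiv.summable_iff (f := fun j => ‖Sum.elim ξ η j‖ ^ 2)).2 (Summable.sum _ hξ hη))⟩,
    fun _ => rfl⟩

/-- Stacking both sequences of a normal functional into one vector lets a single vector functional
control them. -/
theorem exists_norm_amplify_sq {ξ η : ℕ → H} (hξ : Summable fun n => ‖ξ n‖ ^ 2)
    (hη : Summable fun n => ‖η n‖ ^ 2) : ∃ ζ : lp (fun _ : Multiplicative ℤ => H) 2,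
      ∀ X : H →L[ℂ] H, HasSum (fun n => ‖X (ξ n)‖ ^ 2 + ‖X (η n)‖ ^ 2) (‖amplify H X ζ‖ ^ 2) := by
  obtain ⟨ζ, hζ₀⟩ := exists_lp_sumElim hξ hη
  refine ⟨ζ, fun X => ?_⟩
  have hζ (i : Multiplicative ℤ) : amplify H X ζ i = X (Sum.elim ξ η (sumEquiv i)) := by
    rw [amplify_apply, hζ₀]
  have hs1 : Summable fun j : ℕ ⊕ ℕ => ‖X (Sum.elim ξ η j)‖ ^ 2 := by
    have := summable_sq_of_lp (amplify H X ζ)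
    simp only [hζ] at this
    exact (sumEquiv.summable_iff (f := fun j => ‖X (Sum.elim ξ η j)‖ ^ 2)).1 this
  have hξ1 : Summable fun n => ‖X (ξ n)‖ ^ 2 := by
    have := hs1.comp_injective Sum.inl_injective
    exact this
  have hη1 : Summable fun n => ‖X (η n)‖ ^ 2 := by
    have := hs1.comp_injective Sum.inr_injective
    exact this
  have h1 : ‖amplify H X ζ‖ ^ 2 = ∑' n, ‖X (ξ n)‖ ^ 2 + ∑' n, ‖X (η n)‖ ^ 2 := by
    rw [lp_norm_sq]
    simp only [hζ]
    rw [sumEquiv.tsum_eq fun j => ‖X (Sum.elim ξ η j)‖ ^ 2]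
    exact Summable.tsum_sum hξ1 hη1
  rw [h1]
  exact hξ1.hasSum.add hη1.hasSum

/-- The amplification as a representation of a von Neumann algebra. -/
def amplifiedRep (M : VonNeumannAlgebra H) :
    M.toStarSubalgebra →⋆ₐ[ℂ] (lp (fun _ : Multiplicative ℤ => H) 2 →L[ℂ]
      lp (fun _ : Multiplicative ℤ => H) 2) :=
  (amplify H).comp M.toStarSubalgebra.subtype

/-- A normal positive functional is dominated by a vector functional of the amplification. -/
theorem IsFaithfulNormalState.exists_dominating {φ : M.toStarSubalgebra →ₚ[ℂ] ℂ}
    (hφ : IsFaithfulNormalState φ) : ∃ ζ : lp (fun _ : Multiplicative ℤ => H) 2,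
      ∀ x : M.toStarSubalgebra, ‖φ.toPreGNS x‖ ≤ ‖amplifiedRep M x ζ‖ := by
  obtain ⟨ξ, η, hξ, hη, hsum⟩ := hφ.normal
  obtain ⟨ζ, hζ⟩ := exists_norm_amplify_sq hξ hη
  refine ⟨ζ, fun x => ?_⟩
  have h1 := hζ x
  -- Moving `x⋆` to the left slot and using `a b ≤ a² + b²` bounds each term of the series for `φ(x⋆
  -- x)`.
  have h2 (n : ℕ) : ‖⟪η n, ((star x * x : M.toStarSubalgebra) : H →L[ℂ] H) (ξ n)⟫_ℂ‖ ≤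
      ‖(x : H →L[ℂ] H) (ξ n)‖ ^ 2 + ‖(x : H →L[ℂ] H) (η n)‖ ^ 2 := by
    have h : ⟪η n, ((star x * x : M.toStarSubalgebra) : H →L[ℂ] H) (ξ n)⟫_ℂ =
        ⟪(x : H →L[ℂ] H) (η n), (x : H →L[ℂ] H) (ξ n)⟫_ℂ := by
      change ⟪η n, (star (x : H →L[ℂ] H)) ((x : H →L[ℂ] H) (ξ n))⟫_ℂ = _
      rw [ContinuousLinearMap.star_eq_adjoint, ContinuousLinearMap.adjoint_inner_right]
    rw [h]
    refine (norm_inner_le_norm _ _).trans ?_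
    nlinarith [sq_nonneg (‖(x : H →L[ℂ] H) (η n)‖ - ‖(x : H →L[ℂ] H) (ξ n)‖),
      sq_nonneg ‖(x : H →L[ℂ] H) (η n)‖, sq_nonneg ‖(x : H →L[ℂ] H) (ξ n)‖]
  have h3 := PositiveLinearMap.preGNS_norm_sq φ (φ.toPreGNS x)
  rw [PositiveLinearMap.ofPreGNS_toPreGNS] at h3
  have h4 : ‖φ.toPreGNS x‖ ^ 2 = ‖φ (star x * x)‖ := by
    rw [← h3, norm_pow, Complex.norm_real, norm_norm]
  rw [← sq_le_sq₀ (norm_nonneg _) (norm_nonneg _), h4, ← (hsum (star x * x)).tsum_eq]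
  exact tsum_of_norm_bounded h1 h2

theorem gnsStarAlgHom_gnsVector {φ : M.toStarSubalgebra →ₚ[ℂ] ℂ} (hφ : φ 1 = 1)
    (x : M.toStarSubalgebra) :
    φ.gnsStarAlgHom x (gnsVector φ hφ : φ.GNS) = (φ.toPreGNS x : φ.PreGNS) := by
  refine (gnsStarAlgHom_coe φ x (φ.toPreGNS 1)).trans ?_
  rw [PositiveLinearMap.ofPreGNS_toPreGNS, mul_one]

set_option maxHeartbeats 800000 in
/-- The canonical vector is cyclic for the commutant of the GNS representation. -/
theorem IsFaithfulNormalState.dense_commutant_apply {φ : M.toStarSubalgebra →ₚ[ℂ] ℂ}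
    (hφ : IsFaithfulNormalState φ) :
    Dense {h : φ.GNS | ∃ c ∈ StarSubalgebra.centralizer ℂ (Set.range φ.gnsStarAlgHom),
      c (gnsVector φ hφ.map_one) = h} := by
  obtain ⟨ζ, hζ⟩ := hφ.exists_dominating
  obtain ⟨K, hKinj, hK⟩ := exists_injective_intertwiner (amplifiedRep M) hζ
  refine dense_gns_commutant_apply hKinj hK ?_
  have hset : amplify H '' M = Set.range (amplifiedRep M) := by
    ext T
    exact ⟨fun ⟨x, hx, h⟩ => ⟨⟨x, hx⟩, h⟩, fun ⟨x, h⟩ => ⟨x, x.2, h⟩⟩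
  rw [← hset]
  -- It remains to see that `K ξ_φ` is separating: if `x` kills it, injectivity of `K` gives `π_φ(x)
  -- ξ_φ = 0`, so `φ(x⋆ x) = 0` and `x = 0` by faithfulness.
  refine dense_amplifiedCommutant_apply M fun x hx h => ?_
  let y : M.toStarSubalgebra := ⟨x, hx⟩
  have h1 : K (φ.gnsStarAlgHom y (gnsVector φ hφ.map_one : φ.GNS)) = K 0 := by
    rw [hK, map_zero]
    exact h
  have h2 := hKinj h1
  rw [gnsStarAlgHom_gnsVector, ← norm_eq_zero, UniformSpace.Completion.norm_coe] at h2
  have h3 := PositiveLinearMap.preGNS_norm_sq φ (φ.toPreGNS y)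
  rw [h2, PositiveLinearMap.ofPreGNS_toPreGNS] at h3
  have h4 := hφ.faithful _ (star_mul_self_nonneg y) (by simpa using h3.symm)
  exact congrArg Subtype.val (CStarRing.star_mul_self_eq_zero_iff y |>.1 h4)

end GNS
end

theorem theorem6p1 {α : Ordinal.{v}} (hα : Order.IsSuccLimit α) (hcof : Cardinal.aleph0 < α.cof)
    (Γ : Set.Iio α → Type u) [∀ β, Group (Γ β)] (hΓ : ∀ β, Nontrivial (Γ β))
    (G : Type w) [Group G] (hG : IsIteratedWreathProduct Γ G) :
    (∀ (A : Type*) [CStarAlgebra A]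
      (H : Type*) [NormedAddCommGroup H] [InnerProductSpace ℂ H] [CompleteSpace H]
      (π : A →⋆ₐ[ℂ] (H →L[ℂ] H)) (_ : Function.Injective π) (ξ : UnitVector H),
      NoNontrivialCentralSequences (cstarWreath π ξ G)) ∧
    (∀ (H : Type*) [NormedAddCommGroup H] [InnerProductSpace ℂ H] [CompleteSpace H]
      (M : VonNeumannAlgebra H) (φ : M.toStarSubalgebra →ₚ[ℂ] ℂ) (hφ : IsFaithfulNormalState φ),
      (vonNeumannWreath φ hφ.map_one G).NoNontrivialCentralSequences) := by
  have hfree := hG.hasFreeConjugators hα hcof hΓ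
  refine ⟨?_, ?_⟩
  · intro A _ H _ _ _ π _ ξ
    exact hfree.noNontrivialCentralSequences_cstarWreath π ξ
  · intro H _ _ _ M φ hφ
    exact hfree.noNontrivialCentralSequences_crossedProduct hφ.dense_commutant_apply
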